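/- Let $p$ be a prime, $K$ a field of characteristic $p$, and $G$ a nonabelian locally finite $p$-group. Let $V(KG)$ be the group of normalized units of the group algebra $KG$, that is, the units with augmentation $1$. Let $a\mapsto a^*$ be the $K$-linear extension to $KG$ of $g\mapsto g^{-1}$, and let $V_*(KG)=\{v\in V(KG) : v^*=v^{-1}\}$ be the subgroup of unitary normalized units. Then $V_*(KG)$ is normal in $V(KG)$ if and only if $p=2$ and $G$ is the direct product $E\times H$ of an elementary abelian $2$-group $E$ (possibly trivial or infinite) and a group $H$ for which one of the following holds: (i) $H$ has no direct factor of order $2$, but it is a semidirect product of a group $\langle h\rangle$ of order $2$ and an abelian normal $2$-subgroup $A$, with $h^{-1}ah=a^{-1}$ for all $a\in A$; (ii) $H$ is an extraspecial $2$-group, or the central product of an extraspecial $2$-group with a cyclic group of order $4$, formed by identifying the centre of the extraspecial group with the subgroup of order $2$ of the cyclic group. Here a $2$-group, not necessarily finite, is called extraspecial if its centre, commutator subgroup and Frattini subgroup (the intersection of the maximal subgroups) are equal and have order $2$. -/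

import Mathlib

noncomputable section

/-- Every finitely generated subgroup is finite. -/
def IsLocallyFiniteGroup (G : Type*) [Group G] : Prop :=
  ∀ S : Subgroup G, S.FG → Finite S

/-! ### The group algebra, its involution and its (unitary) normalized units -/

section GroupAlgebra

variable (K : Type*) [Field K] (G : Type*) [Group G]

/-- The augmentation map of `KG`: the algebra homomorphism to `K` sending every `g` to `1`. -/
def groupAugmentation : MonoidAlgebra K G →ₐ[K] K :=
  MonoidAlgebra.lift K K G 1

/-- The `K`-linear extension `a ↦ a^*` to `KG` of the inversion `g ↦ g⁻¹` of `G`. -/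
def groupStar (a : MonoidAlgebra K G) : MonoidAlgebra K G :=
  MonoidAlgebra.mapDomain (fun g : G => g⁻¹) a

theorem groupStar_one : groupStar K G 1 = 1 := by
  simp [groupStar, MonoidAlgebra.one_def]

theorem groupStar_mul (a b : MonoidAlgebra K G) :
    groupStar K G (a * b) = groupStar K G b * groupStar K G a := by
  induction a using MonoidAlgebra.induction_linear with
  | zero => simp [groupStar]
  | add x y hx hy =>
    simp only [groupStar] at hx hy ⊢
    rw [add_mul, MonoidAlgebra.mapDomain_add, MonoidAlgebra.mapDomain_add, hx, hy, mul_add]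
  | single g r =>
    induction b using MonoidAlgebra.induction_linear with
    | zero => simp [groupStar]
    | add x y hx hy =>
      simp only [groupStar] at hx hy ⊢
      rw [mul_add, MonoidAlgebra.mapDomain_add, MonoidAlgebra.mapDomain_add, hx, hy, add_mul]
    | single h s =>
      simp [groupStar, MonoidAlgebra.single_mul_single, mul_comm r s]

/-- The group `V(KG)` of normalized units: the units of `KG` with augmentation `1`. -/
def normalizedUnits : Subgroup (MonoidAlgebra K G)ˣ :=
  (Units.map (groupAugmentation K G : MonoidAlgebra K G →* K)).ker

/-- The subgroup `V_*(KG)` of `V(KG)` consisting of the unitary normalized units: those `v`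
with `v^* = v⁻¹`. -/
def unitaryNormalizedUnits : Subgroup (normalizedUnits K G) where
  carrier := {v | groupStar K G ((v : (MonoidAlgebra K G)ˣ) : MonoidAlgebra K G) =
    ((v⁻¹ : normalizedUnits K G) : (MonoidAlgebra K G)ˣ)}
  one_mem' := by simp [groupStar_one]
  mul_mem' := by
    intro v w hv hw
    simp only [Set.mem_ofPred_eq] at hv hw ⊢
    simp [groupStar_mul, hv, hw]
  inv_mem' := by
    intro v hv
    simp only [Set.mem_ofPred_eq] at hv ⊢
    rw [← hv, inv_inv]
    have hinv : ∀ a : MonoidAlgebra K G, groupStar K G (groupStar K G a) = a := by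
      intro a
      induction a using MonoidAlgebra.induction_linear with
      | zero => simp [groupStar]
      | add x y hx hy =>
        simp only [groupStar] at hx hy ⊢
        rw [MonoidAlgebra.mapDomain_add, MonoidAlgebra.mapDomain_add, hx, hy]
      | single g r => simp [groupStar]
    exact hinv _

end GroupAlgebra

/-! ### Group-theoretic notions -/

/-- An elementary abelian `p`-group, of any rank (finite, infinite or zero). -/
def IsElementaryAbelian (p : ℕ) (E : Type*) [Group E] : Prop :=
  (∀ x y : E, x * y = y * x) ∧ ∀ x : E, x ^ p = 1

/-- `G` is the (internal) direct product of its subgroups `C` and `D`. -/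
def IsDirectProductOf {G : Type*} [Group G] (C D : Subgroup G) : Prop :=
  C.Normal ∧ D.Normal ∧ Subgroup.IsComplement' C D

/-- `H` has a direct factor of order `2`. -/
def HasDirectFactorOfOrderTwo (H : Type*) [Group H] : Prop :=
  ∃ C D : Subgroup H, IsDirectProductOf C D ∧ Nat.card C = 2

/-- `H` is a semidirect product of a subgroup `⟨h⟩` of order `2` and an abelian normal `2`-subgroup
`A` with `h⁻¹ a h = a⁻¹` for all `a` in `A`. -/
def IsInvertingSemidirectProduct (H : Type*) [Group H] : Prop :=
  ∃ (h : H) (A : Subgroup H),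
    orderOf h = 2 ∧ A.Normal ∧ Subgroup.IsComplement' A (Subgroup.zpowers h) ∧
    IsPGroup 2 A ∧ (∀ a ∈ A, ∀ b ∈ A, a * b = b * a) ∧ ∀ a ∈ A, h⁻¹ * a * h = a⁻¹

/-- An extraspecial `p`-group, not required to be finite: a `p`-group whose centre, commutator
subgroup and Frattini subgroup are equal and have order `p`. -/
def IsExtraspecial (p : ℕ) (H : Type*) [Group H] : Prop :=
  IsPGroup p H ∧ Subgroup.center H = commutator H ∧ Subgroup.center H = frattini H ∧
    Nat.card (Subgroup.center H) = p

/-- `H` is the central product of an extraspecial `2`-group `S` with a cyclic group `C` of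
order `4`: these are subgroups which commute elementwise, generate `H`, and whose intersection is
the centre of `S` (thus the centre of `S` is identified with the subgroup of order `2` of `C`). -/
def IsCentralProductExtraspecialC4 (H : Type*) [Group H] : Prop :=
  ∃ S C : Subgroup H,
    IsExtraspecial 2 S ∧ IsCyclic C ∧ Nat.card C = 4 ∧
    (∀ s ∈ S, ∀ c ∈ C, s * c = c * s) ∧ S ⊔ C = ⊤ ∧
    S ⊓ C = (Subgroup.center S).map S.subtype

end

/-!
Since `G ⊆ V_*(KG)`, and a conjugate `v⁻¹ u v` of a unitary unit `u` is unitary exactly when `v v^*`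
commutes with `u`, the subgroup `V_*(KG)` is normal if and only if `v v^*` is central in `KG` for
every normalized unit `v` (`unitaryNormalizedUnits_normal_iff`).

For `p` odd, the unit `v = 2 - g` shows that `g + g⁻¹` is central, so that every element of `G`
either centralizes or inverts `g`; an element of odd order cannot invert `g ≠ 1`, hence `G` is
abelian (`mul_comm_of_normal`). For `p = 2`, the units `v = 1 + a + x⁻¹` yield, on comparing coefficients,
the condition `ConjEqSelfOrInv G`: an element with `g² ≠ 1` has no conjugates other than `g` and
`g⁻¹`. Conversely, this condition says that every `g + g⁻¹` is central, and `v v^*` is a scalar plus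
a combination of such elements. That `2 - g` and `1 + a + x⁻¹` are units follows from
`isUnit_of_groupAugmentation_ne_zero`: over `𝔽_p`, the left annihilator of `x` is acted on by the
finite `p`-group, so if it is nonzero it contains a nonzero fixed vector, a multiple of the sum of
all group elements, on which `x` acts by its augmentation.

It remains to classify the nonabelian `2`-groups with `ConjEqSelfOrInv`. There is a noncentral `g`
with `g² ≠ 1`. If every element outside the centralizer `A` of `g` is an involution, each of these
inverts `A` (`ConjEqSelfOrInv.isInvertedBy_centralizer`). Otherwise `g` and some `x` outside `A`
generate a quaternion group `Q` of order `8`, `G = Q C(Q)`, and all squares and commutators of `G`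
lie in `{1, g²}` (`ConjEqSelfOrInv.squaresCommutatorsIn`). In both cases the elementary abelian factor
`E` is split off by linear algebra over `𝔽₂` in quotients of exponent `2`
(`exists_complement_modulo`).
-/

/-! ### The involution and normality -/

section Star

variable {K : Type*} [Field K] {G : Type*} [Group G]

open MonoidAlgebra in
theorem groupStar_single (g : G) (r : K) : groupStar K G (single g r) = single g⁻¹ r := by
  simp [groupStar]

theorem groupStar_add (a b : MonoidAlgebra K G) :
    groupStar K G (a + b) = groupStar K G a + groupStar K G b := by
  simp [groupStar, MonoidAlgebra.mapDomain_add]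

theorem groupStar_sub (a b : MonoidAlgebra K G) :
    groupStar K G (a - b) = groupStar K G a - groupStar K G b := by
  rw [eq_sub_iff_add_eq, ← groupStar_add, sub_add_cancel]

theorem groupStar_groupStar (a : MonoidAlgebra K G) : groupStar K G (groupStar K G a) = a := by
  induction a using MonoidAlgebra.induction_linear with
  | zero => simp [groupStar]
  | add x y hx hy => rw [groupStar_add, groupStar_add, hx, hy]
  | single g r => rw [groupStar_single, groupStar_single, inv_inv]

theorem groupAugmentation_single (g : G) (r : K) :
    groupAugmentation K G (MonoidAlgebra.single g r) = r := by
  simp [groupAugmentation]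

theorem commute_of_commute_single {x : MonoidAlgebra K G}
    (h : ∀ g : G, Commute x (MonoidAlgebra.single g 1)) (y : MonoidAlgebra K G) :
    Commute x y := by
  induction y using MonoidAlgebra.induction_linear with
  | zero => exact Commute.zero_right x
  | add y z hy hz => exact hy.add_right hz
  | single g r =>
    have := (h g).smul_right r
    rwa [MonoidAlgebra.smul_single, smul_eq_mul, mul_one] at this

/-- For a unitary unit `u`, the conjugate `v⁻¹ u v` is unitary exactly when `v v^*` commutes with
`u⁻¹`. -/
theorem groupStar_conj_eq_inv_iff (u v : (MonoidAlgebra K G)ˣ)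
    (hu : groupStar K G u = (u⁻¹ : (MonoidAlgebra K G)ˣ)) :
    groupStar K G (v⁻¹ * u * v : (MonoidAlgebra K G)ˣ) =
        ((v⁻¹ * u * v)⁻¹ : (MonoidAlgebra K G)ˣ) ↔
      Commute ((v : MonoidAlgebra K G) * groupStar K G v)
        ((u⁻¹ : (MonoidAlgebra K G)ˣ) : MonoidAlgebra K G) := by
  have h1 : groupStar K G v * groupStar K G (v⁻¹ : (MonoidAlgebra K G)ˣ) = 1 := by
    rw [← groupStar_mul, Units.inv_mul, groupStar_one]
  have h2 : groupStar K G (v⁻¹ : (MonoidAlgebra K G)ˣ) * groupStar K G v = 1 := by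
    rw [← groupStar_mul, Units.mul_inv, groupStar_one]
  let w : (MonoidAlgebra K G)ˣ := ⟨_, _, h1, h2⟩
  have hw : groupStar K G v = w := rfl
  have hw' : groupStar K G (v⁻¹ : (MonoidAlgebra K G)ˣ) = (w⁻¹ : (MonoidAlgebra K G)ˣ) := rfl
  rw [Units.val_mul, Units.val_mul, groupStar_mul, groupStar_mul, hu, hw, hw', commute_iff_eq]
  norm_cast
  constructor
  · intro h
    have h' : w * u⁻¹ = (v⁻¹ * u * v)⁻¹ * w := by rw [← h]; group
    calc v * w * u⁻¹ = v * (w * u⁻¹) := by group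
      _ = u⁻¹ * (v * w) := by rw [h']; group
  · intro h
    have h' : w * u⁻¹ = v⁻¹ * u⁻¹ * v * w := by
      calc w * u⁻¹ = v⁻¹ * (v * w * u⁻¹) := by group
        _ = _ := by rw [h]; group
    rw [← mul_assoc, h']; group

/-- The elements of `G`, as normalized units. -/
noncomputable def groupToNormalizedUnits (g : G) : normalizedUnits K G :=
  ⟨⟨MonoidAlgebra.single g 1, MonoidAlgebra.single g⁻¹ 1,
      by simp [MonoidAlgebra.single_mul_single, MonoidAlgebra.one_def],
      by simp [MonoidAlgebra.single_mul_single, MonoidAlgebra.one_def]⟩, by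
    rw [normalizedUnits, MonoidHom.mem_ker, Units.ext_iff]
    simp [groupAugmentation_single]⟩

theorem groupToNormalizedUnits_mem (g : G) :
    groupToNormalizedUnits (K := K) g ∈ unitaryNormalizedUnits K G :=
  groupStar_single g 1

theorem mem_unitaryNormalizedUnits {v : normalizedUnits K G} :
    v ∈ unitaryNormalizedUnits K G ↔
      groupStar K G (v : (MonoidAlgebra K G)ˣ) =
        ((v : (MonoidAlgebra K G)ˣ)⁻¹ : (MonoidAlgebra K G)ˣ) :=
  Iff.rfl

theorem unitaryNormalizedUnits_normal_iff :
    (unitaryNormalizedUnits K G).Normal ↔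
      ∀ v : (MonoidAlgebra K G)ˣ, v ∈ normalizedUnits K G → ∀ g : G,
        Commute ((v : MonoidAlgebra K G) * groupStar K G v) (MonoidAlgebra.single g 1) := by
  constructor
  · intro hN v hv g
    have h := hN.conj_mem _ (groupToNormalizedUnits_mem (K := K) g⁻¹) ⟨v, hv⟩⁻¹
    rw [inv_inv, mem_unitaryNormalizedUnits] at h
    have := (groupStar_conj_eq_inv_iff _ v (groupToNormalizedUnits_mem (K := K) g⁻¹)).1 h
    simpa [groupToNormalizedUnits] using this
  · intro h
    refine ⟨fun u hu v => ?_⟩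
    rw [mem_unitaryNormalizedUnits] at hu ⊢
    have := (groupStar_conj_eq_inv_iff (u : (MonoidAlgebra K G)ˣ)
      ((v : (MonoidAlgebra K G)ˣ)⁻¹) hu).2
      (commute_of_commute_single (h _ (inv_mem v.2)) _)
    simpa using this

end Star

/-! ### Units of the group algebra of a finite `p`-group -/

section Units

variable {p : ℕ} [Fact p.Prime]

/-- The group algebra of a finite `p`-group over `𝔽_p` is local, its maximal ideal being the
augmentation ideal. As the algebra is finite, it is enough that `x` has no left annihilator. -/
theorem isUnit_of_groupAugmentation_ne_zero {H : Type*} [Group H] [Finite H] (hH : IsPGroup p H)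
    (x : MonoidAlgebra (ZMod p) H) (hx : groupAugmentation (ZMod p) H x ≠ 0) : IsUnit x := by
  have : Finite (MonoidAlgebra (ZMod p) H) := 
    Finite.of_injective (fun w h => w.coeff h) fun w w' h => by
      ext a
      exact congrFun h a
  apply IsRightRegular.isUnit_of_finite
  rw [isRightRegular_iff_left_eq_zero_of_mul]
  by_contra! hcon
  obtain ⟨w₀, hw₀, hne⟩ := hcon
  let W : AddSubgroup (MonoidAlgebra (ZMod p) H) := (AddMonoidHom.mulRight x).ker
  have hW : ∀ w, w ∈ W ↔ w * x = 0 := fun w => by simp [W, AddMonoidHom.mem_ker]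
  let _ : MulAction H W :=
    { smul := fun h w => ⟨MonoidAlgebra.single h (1 : ZMod p) * w.1, by
        rw [hW, mul_assoc, (hW _).1 w.2, mul_zero]⟩
      one_smul := fun w => Subtype.ext (by
        change MonoidAlgebra.single 1 1 * w.1 = w.1
        rw [← MonoidAlgebra.one_def, one_mul])
      mul_smul := fun a b w => Subtype.ext (by
        change MonoidAlgebra.single (a * b) 1 * w.1 =
          MonoidAlgebra.single a 1 * (MonoidAlgebra.single b 1 * w.1)
        rw [← mul_assoc, MonoidAlgebra.single_mul_single, mul_one]) }
  have hsmul : ∀ (h : H) (w : W), (h • w).1 = MonoidAlgebra.single h 1 * w.1 := fun _ _ => rfl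
  have hcard : p ∣ Nat.card W := by
    have : addOrderOf (⟨w₀, (hW _).2 hw₀⟩ : W) = p := by
      refine addOrderOf_eq_prime (Subtype.ext ?_) (fun h => hne (congrArg Subtype.val h))
      change p • w₀ = 0
      rw [← Nat.cast_smul_eq_nsmul (ZMod p), CharP.cast_eq_zero, zero_smul]
    exact this.symm.dvd.trans (addOrderOf_dvd_natCard _)
  have h0 : (0 : W) ∈ MulAction.fixedPoints H W := fun h => Subtype.ext (by
    rw [hsmul]; simp)
  -- A nonzero vector fixed by left multiplication has constant coefficients.
  obtain ⟨w, hw, hw0⟩ := hH.exists_fixed_point_of_prime_dvd_card_of_fixed_point W hcard h0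
  have hfix : ∀ h : H, MonoidAlgebra.single h 1 * w.1 = w.1 :=
    fun h => congrArg Subtype.val (hw h)
  have hconst : ∀ h : H, w.1.coeff h =
      w.1.coeff 1 := fun h => by
    conv_lhs => rw [← hfix h]
    simp
  have hmul : ∀ y, w.1 * y =
      groupAugmentation (ZMod p) H y • w.1 := fun y => by
    induction y using MonoidAlgebra.induction_linear with
    | zero => simp
    | add y z hy hz => rw [mul_add, hy, hz, map_add, add_smul]
    | single g r =>
      ext h
      rw [groupAugmentation_single]
      simp [hconst h, hconst (h * g⁻¹), mul_comm]
  have := (hW _).1 w.2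
  rw [hmul, smul_eq_zero] at this
  rcases this with h | h
  · exact hx h
  · exact hw0 (Subtype.ext h.symm)

variable {K : Type*} [Field K] [CharP K p] {G : Type*} [Group G]

/-- The change of scalars and of groups `𝔽_p[S] → K[G]` for a subgroup `S` of `G`. -/
noncomputable def primeFieldSubgroupAlgebraHom (p : ℕ) (K : Type*) [Field K] [CharP K p]
    {G : Type*} [Group G] (S : Subgroup G) :
    MonoidAlgebra (ZMod p) S →+* MonoidAlgebra K G :=
  (MonoidAlgebra.mapDomainRingHom K S.subtype).comp
    (MonoidAlgebra.mapRingHom S (ZMod.castHom dvd_rfl K))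

omit [Fact p.Prime] in
theorem primeFieldSubgroupAlgebraHom_single (S : Subgroup G) (s : S) (r : ZMod p) :
    primeFieldSubgroupAlgebraHom p K S (MonoidAlgebra.single s r) =
      MonoidAlgebra.single (s : G) (r.cast : K) := by
  simp [primeFieldSubgroupAlgebraHom]

theorem isUnit_primeFieldSubgroupAlgebraHom (hp : IsPGroup p G) (hlf : IsLocallyFiniteGroup G)
    {S : Subgroup G} (hS : S.FG) (x : MonoidAlgebra (ZMod p) S)
    (hx : groupAugmentation (ZMod p) S x ≠ 0) :
    IsUnit (primeFieldSubgroupAlgebraHom p K S x) := by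
  have := hlf S hS
  exact (isUnit_of_groupAugmentation_ne_zero (hp.to_subgroup S) x hx).map _

end Units

/-! ### Normality as a condition on conjugates -/

/-- Every element of `G` whose square is not `1` has no conjugates besides itself and its inverse.
For elements with `g² = 1` nothing is required. -/
def ConjEqSelfOrInv (G : Type*) [Group G] : Prop :=
  ∀ g x : G, g ^ 2 = 1 ∨ x * g * x⁻¹ = g ∨ x * g * x⁻¹ = g⁻¹

section Normality

open MonoidAlgebra (single single_mul_single)

variable {K : Type*} [Field K] {G : Type*} [Group G]

theorem mem_normalizedUnits {v : (MonoidAlgebra K G)ˣ} :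
    v ∈ normalizedUnits K G ↔ groupAugmentation K G v = 1 := by
  rw [normalizedUnits, MonoidHom.mem_ker, Units.ext_iff]
  simp

/-- The traces `w + w^*` are central: for `w = g` with `g² = 1` the trace is `2 g = 0`, and
otherwise conjugation permutes `{g, g⁻¹}`. -/
theorem commute_add_groupStar [CharP K 2] (hG : ConjEqSelfOrInv G) (w : MonoidAlgebra K G) (x : G) :
    Commute (w + groupStar K G w) (single x 1) := by
  induction w using MonoidAlgebra.induction_linear with
  | zero => simp [groupStar]
  | add y z hy hz =>
    rw [groupStar_add, add_add_add_comm]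
    exact hy.add_left hz
  | single g r =>
    rw [groupStar_single]
    rcases hG g x with h | h | h
    · have hinv : g⁻¹ = g := by rw [inv_eq_iff_mul_eq_one, ← sq, h]
      rw [hinv, ← MonoidAlgebra.single_add, CharTwo.add_self_eq_zero, MonoidAlgebra.single_zero]
      exact Commute.zero_left _
    · have hc : x * g = g * x := by rw [← eq_mul_inv_iff_mul_eq.1 h.symm]
      have hc' : x * g⁻¹ = g⁻¹ * x := (Commute.inv_right (show Commute x g from hc)).eq
      simp [commute_iff_eq, add_mul, mul_add, single_mul_single, hc, hc']
    · have hc : x * g = g⁻¹ * x := by rw [← h]; group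
      have hc' : x * g⁻¹ = g * x := by
        rw [← mul_inv_eq_iff_eq_mul, ← conj_inv, h, inv_inv]
      simp [commute_iff_eq, add_mul, mul_add, single_mul_single, hc, hc', add_comm]

/-- The norm `w w^*` is additive in `w` up to the traces `y z^* + (y z^*)^*`, and it is scalar on
multiples of group elements. -/
theorem commute_mul_groupStar [CharP K 2] (hG : ConjEqSelfOrInv G) (w : MonoidAlgebra K G) (x : G) :
    Commute (w * groupStar K G w) (single x 1) := by
  induction w using MonoidAlgebra.induction_linear with
  | zero => simp [groupStar]
  | add y z hy hz =>
    have h : (y + z) * groupStar K G (y + z) = y * groupStar K G y + z * groupStar K G z +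
        (y * groupStar K G z + groupStar K G (y * groupStar K G z)) := by
      rw [groupStar_mul, groupStar_groupStar, groupStar_add, add_mul, mul_add, mul_add]
      abel
    rw [h]
    exact (hy.add_left hz).add_left (commute_add_groupStar hG _ x)
  | single g r =>
    simp [groupStar_single, commute_iff_eq, single_mul_single]

theorem unitaryNormalizedUnits_normal_of_conjEqSelfOrInv [CharP K 2] (hG : ConjEqSelfOrInv G) :
    (unitaryNormalizedUnits K G).Normal := by
  rw [unitaryNormalizedUnits_normal_iff]
  intro v _ x
  exact commute_mul_groupStar hG _ x

/-- For `v = 1 + a + x⁻¹`, the product `v v^*` is `3` plus the sum of the traces of `a`, `x` and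
`a x`. Commuting it with `x` leaves an identity with eight terms, in which `a x` occurs once if
`a² ≠ 1` and `x a x⁻¹` differs from `a` and `a⁻¹`. -/
theorem conjEqSelfOrInv_of_normal [CharP K 2] (hp : IsPGroup 2 G) (hlf : IsLocallyFiniteGroup G)
    (hN : (unitaryNormalizedUnits K G).Normal) : ConjEqSelfOrInv G := by
  intro a x
  by_contra! hcon
  obtain ⟨hsq, hcomm, hinv⟩ := hcon
  let S := Subgroup.closure {a, x}
  have hS : S.FG := (Subgroup.fg_iff _).2 ⟨{a, x}, rfl, by simp⟩
  have ha : a ∈ S := Subgroup.subset_closure (by simp)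
  have hx : x ∈ S := Subgroup.subset_closure (by simp)
  obtain ⟨v, hv⟩ := isUnit_primeFieldSubgroupAlgebraHom (K := K) hp hlf hS
    (single 1 1 + single ⟨a, ha⟩ 1 + single ⟨x, hx⟩⁻¹ 1) (by
      simp only [map_add, groupAugmentation_single]
      decide)
  simp only [map_add, primeFieldSubgroupAlgebraHom_single] at hv
  have h3 : (1 + 1 + 1 : K) = 1 := by rw [CharTwo.add_self_eq_zero, zero_add]
  have hmem : v ∈ normalizedUnits K G := by
    rw [mem_normalizedUnits, hv]
    simp [groupAugmentation_single, h3]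
  have h := unitaryNormalizedUnits_normal_iff.1 hN v hmem x
  rw [hv, commute_iff_eq, ← sub_eq_zero] at h
  simp only [groupStar_add, groupStar_single] at h
  simp [add_mul, mul_add, single_mul_single, mul_assoc] at h
  have h' : single (a * x) (1 : K) + single (a⁻¹ * x) 1 + single (a * (x * x)) 1 +
      single (x⁻¹ * (a⁻¹ * x)) 1 - (single (x * a) 1 + single (x * a⁻¹) 1 +
        single (x * (a * x)) 1 + single a⁻¹ 1) = 0 := by
    rw [← h]
    abel
  have h'' := congrArg (fun w => w.coeff (a * x)) h'
  have ha1 : a ≠ 1 := fun e => hsq (by simp [e])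
  have e1 : x * a ≠ a * x := fun e => hcomm (by rw [e]; group)
  have hx1 : x ≠ 1 := fun e => e1 (by simp [e])
  have e2 : x * a⁻¹ ≠ a * x := fun e => hinv (by
    rw [← inv_inj, inv_inv, conj_inv, e]; group)
  have e3 : x * (a * x) ≠ a * x := fun e => hx1 (mul_eq_right.1 e)
  have hx2 : x ≠ a⁻¹ * a⁻¹ := fun e => e1 (by rw [e]; group)
  have e4 : a⁻¹ ≠ a * x := fun e => hx2 (by rw [eq_inv_mul_iff_mul_eq, ← e])
  have e5 : a⁻¹ * x ≠ a * x := fun e => hsq (by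
    rw [sq, ← inv_eq_iff_mul_eq_one]; exact mul_right_cancel e)
  have e6 : a * (x * x) ≠ a * x := fun e => hx1 (mul_eq_left.1 (mul_left_cancel e))
  have e7 : x⁻¹ * (a⁻¹ * x) ≠ a * x := fun e => hx2 (by
    rw [← mul_assoc] at e
    rw [← mul_inv_rev, ← inv_eq_iff_eq_inv, ← mul_inv_eq_iff_eq_mul, mul_right_cancel e])
  simp [e1, e2, e3, e4, e5, e6, e7] at h''

theorem IsPGroup.commute_of_commute_sq {p : ℕ} [hp' : Fact p.Prime] (hp2 : p ≠ 2)
    (hp : IsPGroup p G) {x g : G} (h : Commute (x ^ 2) g) : Commute x g := by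
  obtain ⟨k, hk⟩ := hp x
  obtain ⟨m, hm⟩ := (hp'.out.odd_of_ne_two hp2).pow (n := k)
  have : x = (x ^ 2) ^ (m + 1) := by
    rw [← pow_mul, show 2 * (m + 1) = p ^ k + 1 by omega, pow_succ, hk, one_mul]
  rw [this]
  exact h.pow_left _

theorem mul_comm_of_normal {p : ℕ} [Fact p.Prime] [CharP K p] (hp2 : p ≠ 2) (hp : IsPGroup p G)
    (hlf : IsLocallyFiniteGroup G) (hN : (unitaryNormalizedUnits K G).Normal) (x g : G) :
    x * g = g * x := by
  by_contra hcomm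
  -- The unit `2 - g`, with `2` written as `1 + 1`.
  let S := Subgroup.closure {g}
  have hS : S.FG := (Subgroup.fg_iff _).2 ⟨{g}, rfl, by simp⟩
  have hg : g ∈ S := Subgroup.subset_closure (by simp)
  obtain ⟨v, hv⟩ := isUnit_primeFieldSubgroupAlgebraHom (K := K) hp hlf hS
    (single 1 1 + single 1 1 - single ⟨g, hg⟩ 1) (by
      simp [map_sub, map_add, groupAugmentation_single])
  simp only [map_add, map_sub, primeFieldSubgroupAlgebraHom_single] at hv
  have hmem : v ∈ normalizedUnits K G := by
    rw [mem_normalizedUnits, hv]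
    simp [groupAugmentation_single]
  have h := unitaryNormalizedUnits_normal_iff.1 hN v hmem x
  rw [hv, commute_iff_eq, ← sub_eq_zero] at h
  simp only [groupStar_add, groupStar_sub, groupStar_single] at h
  simp [add_mul, mul_add, sub_mul, mul_sub, single_mul_single] at h
  have h' : single (x * g) (1 : K) + single (x * g) 1 + single (x * g⁻¹) 1 + single (x * g⁻¹) 1 -
      (single (g * x) 1 + single (g * x) 1 + single (g⁻¹ * x) 1 + single (g⁻¹ * x) 1) = 0 := by
    rw [← h]
    abel
  have h'' := congrArg (fun w => w.coeff (x * g)) h'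
  have e1 : g * x ≠ x * g := fun e => hcomm e.symm
  have e2 : g⁻¹ ≠ g := fun e => hcomm (by
    have : g ^ 2 = 1 := by rw [sq, ← inv_eq_iff_mul_eq_one, e]
    refine (hp.commute_of_commute_sq hp2 (x := g) (g := x) ?_).eq.symm
    rw [this]
    exact Commute.one_left x)
  have e3 : g⁻¹ * x ≠ x * g := fun e => hcomm (by
    refine (hp.commute_of_commute_sq hp2 (x := x) (g := g) ?_).eq
    have e' : x * g⁻¹ = g * x := by
      rw [← mul_inv_eq_iff_eq_mul, ← conj_inv, ← e]
      group
    rw [commute_iff_eq, sq, mul_assoc, ← e, ← mul_assoc, e', mul_assoc])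
  simp [e1, e2, e3, one_add_one_eq_two] at h''
  have h2 := (CharP.cast_eq_zero_iff K p 2).1 (by exact_mod_cast h'')
  exact hp2 ((Nat.prime_dvd_prime_iff_eq Fact.out Nat.prime_two).1 h2)

end Normality

/-! ### Complements modulo squares -/

section Complements

theorem mul_comm_of_forall_mul_self_eq_one {G : Type*} [Group G] (h : ∀ g : G, g * g = 1)
    (a b : G) : a * b = b * a := by
  have hi : ∀ g : G, g⁻¹ = g := fun g => inv_eq_of_mul_eq_one_left (h g)
  rw [← hi (a * b), mul_inv_rev, hi, hi]

/-- A group of exponent `2` is a vector space over `𝔽₂`, so its subgroups have complements. -/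
theorem exists_isCompl_of_forall_mul_self_eq_one {Q : Type*} [Group Q] (h : ∀ g : Q, g * g = 1)
    (N : Subgroup Q) : ∃ M : Subgroup Q, IsCompl N M := by
  let _ : CommGroup Q := { ‹Group Q› with mul_comm := mul_comm_of_forall_mul_self_eq_one h }
  let _ : Module (ZMod 2) (Additive Q) := AddCommGroup.zmodModule fun x => by
    rw [two_nsmul]
    exact h x.toMul
  have : Fact (Nat.Prime 2) := ⟨Nat.prime_two⟩
  have : ComplementedLattice (Subgroup Q) :=
    ((Subgroup.toAddSubgroup (G := Q)).trans
      (AddSubgroup.toZModSubmodule 2)).symm.complementedLattice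
  exact exists_isCompl N

variable {G : Type*} [Group G]

theorem normal_of_forall_mul_self_mem {D : Subgroup G} (h : ∀ g : G, g * g ∈ D) : D.Normal := by
  refine ⟨fun d hd g => ?_⟩
  have : g * d * g⁻¹ = (g * d) * (g * d) * d⁻¹ * (g * g)⁻¹ := by group
  rw [this]
  exact mul_mem (mul_mem (h _) (inv_mem hd)) (inv_mem (h g))

/-- If `D` contains all squares of `G`, then `G ⧸ D` is a vector space over `𝔽₂`; here `M` is the
preimage of a complement of the image of `E`. -/
theorem exists_complement_modulo_of_forall {D : Subgroup G} (h : ∀ g : G, g * g ∈ D)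
    (E : Subgroup G) :
    ∃ M : Subgroup G, D ≤ M ∧ (∀ g, ∃ e ∈ E, ∃ m ∈ M, e * m = g) ∧ ∀ e ∈ E, e ∈ M → e ∈ D := by
  have := normal_of_forall_mul_self_mem h
  have hQ : ∀ q : G ⧸ D, q * q = 1 := fun q => by
    obtain ⟨g, rfl⟩ := QuotientGroup.mk'_surjective D q
    rw [← map_mul]
    exact (QuotientGroup.eq_one_iff _).2 (h g)
  obtain ⟨M, hM⟩ := exists_isCompl_of_forall_mul_self_eq_one hQ (E.map (QuotientGroup.mk' D))
  refine ⟨M.comap (QuotientGroup.mk' D), ?_, ?_, ?_⟩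
  · intro d hd
    rw [Subgroup.mem_comap, QuotientGroup.mk'_apply, (QuotientGroup.eq_one_iff d).2 hd]
    exact one_mem M
  · intro g
    have hM' : M.Normal := ⟨fun m hm q => by
      rw [mul_comm_of_forall_mul_self_eq_one hQ q m, mul_inv_cancel_right]
      exact hm⟩
    have hg : QuotientGroup.mk' D g ∈ E.map (QuotientGroup.mk' D) ⊔ M := by
      rw [hM.sup_eq_top]
      trivial
    obtain ⟨_, ⟨e, he, rfl⟩, m, hm, hem⟩ := Subgroup.mem_sup_of_normal_right.1 hg
    refine ⟨e, he, e⁻¹ * g, ?_, by group⟩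
    rw [Subgroup.mem_comap, map_mul, ← hem, map_inv, inv_mul_cancel_left]
    exact hm
  · intro e he hem
    have : QuotientGroup.mk' D e ∈ E.map (QuotientGroup.mk' D) ⊓ M := ⟨⟨e, he, rfl⟩, hem⟩
    rw [hM.inf_eq_bot, Subgroup.mem_bot] at this
    exact (QuotientGroup.eq_one_iff e).1 this

/-- The version of `exists_complement_modulo_of_forall` inside a subgroup `P`. It is not required
that `E ≤ P`: the decomposition of an element of `P` only involves `E ⊓ P`. -/
theorem exists_complement_modulo {D P : Subgroup G} (hDP : D ≤ P) (h : ∀ g ∈ P, g * g ∈ D)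
    (E : Subgroup G) :
    ∃ M : Subgroup G, D ≤ M ∧ M ≤ P ∧ (∀ g ∈ P, ∃ e ∈ E, ∃ m ∈ M, e * m = g) ∧
      ∀ e ∈ E, e ∈ M → e ∈ D := by
  obtain ⟨M, hDM, hdec, hinf⟩ := exists_complement_modulo_of_forall (G := P)
    (D := D.subgroupOf P) (fun g => Subgroup.mem_subgroupOf.2 (h g g.2)) (E.subgroupOf P)
  refine ⟨M.map P.subtype, ?_, Subgroup.map_subtype_le M, ?_, ?_⟩
  · intro d hd
    exact ⟨⟨d, hDP hd⟩, hDM (Subgroup.mem_subgroupOf.2 hd), rfl⟩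
  · intro g hg
    obtain ⟨e, he, m, hm, hem⟩ := hdec ⟨g, hg⟩
    exact ⟨e, he, m, ⟨m, hm, rfl⟩, congrArg Subtype.val hem⟩
  · rintro e he ⟨m, hm, rfl⟩
    exact hinf m he hm

end Complements

/-! ### Direct products with a central factor -/

section DirectProduct

variable {G : Type*} [Group G] {E H : Subgroup G}

theorem isDirectProductOf_of_central (hE : ∀ e ∈ E, ∀ g, e * g = g * e)
    (hdec : ∀ g, ∃ e ∈ E, ∃ h ∈ H, e * h = g) (hinf : ∀ e ∈ E, e ∈ H → e = 1) :
    IsDirectProductOf E H := by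
  refine ⟨⟨fun e he g => ?_⟩, ⟨fun h hh g => ?_⟩, ?_⟩
  · rw [← hE e he g, mul_inv_cancel_right]
    exact he
  · obtain ⟨e, he, k, hk, rfl⟩ := hdec g
    have : e * k * h * (e * k)⁻¹ = k * h * k⁻¹ := by
      rw [mul_assoc e, mul_assoc e, hE e he]
      group
    rw [this]
    exact mul_mem (mul_mem hk hh) (inv_mem hk)
  · refine Subgroup.isComplement'_of_disjoint_and_mul_eq_univ ?_ ?_
    · rw [Subgroup.disjoint_def]
      exact fun he hh => hinf _ he hh
    · rw [Set.eq_univ_iff_forall]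
      intro g
      obtain ⟨e, he, h, hh, rfl⟩ := hdec g
      exact Set.mul_mem_mul he hh

theorem isElementaryAbelian_two_of_forall (h : ∀ e ∈ E, e * e = 1) : IsElementaryAbelian 2 E := by
  have h' : ∀ e : E, e * e = 1 := fun e => Subtype.ext (h e e.2)
  exact ⟨mul_comm_of_forall_mul_self_eq_one h', fun e => by rw [sq, h']⟩

theorem ConjEqSelfOrInv.of_isDirectProductOf (hEH : IsDirectProductOf E H)
    (hE : IsElementaryAbelian 2 E) (hH : ConjEqSelfOrInv H) : ConjEqSelfOrInv G := by
  obtain ⟨hEn, hHn, hc⟩ := hEH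
  have hcomm := fun e h he hh =>
    (Subgroup.commute_of_normal_of_disjoint E H hEn hHn hc.disjoint e h he hh).eq
  have hdec : ∀ g : G, ∃ e ∈ E, ∃ h ∈ H, e * h = g := fun g => by
    obtain ⟨⟨e, h⟩, heh⟩ := hc.2 g
    exact ⟨e, e.2, h, h.2, heh⟩
  intro g x
  obtain ⟨e, he, h, hh, rfl⟩ := hdec g
  obtain ⟨e', he', h', hh', rfl⟩ := hdec x
  have hee : e * e = 1 := by
    have := hE.2 ⟨e, he⟩
    rw [sq] at this
    exact congrArg Subtype.val this
  have hee' : e' * e = e * e' := congrArg Subtype.val (hE.1 ⟨e', he'⟩ ⟨e, he⟩)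
  have hconj : e' * h' * (e * h) * (e' * h')⁻¹ = e * (h' * h * h'⁻¹) := by
    have hk := hcomm e' (h' * h * h'⁻¹) he' (mul_mem (mul_mem hh' hh) (inv_mem hh'))
    calc e' * h' * (e * h) * (e' * h')⁻¹ = e' * (h' * e) * h * h'⁻¹ * e'⁻¹ := by group
      _ = e' * e * (h' * h * h'⁻¹) * e'⁻¹ := by rw [← hcomm e h' he hh']; group
      _ = e * (e' * (h' * h * h'⁻¹)) * e'⁻¹ := by rw [hee']; group
      _ = _ := by rw [hk]; group
  rw [hconj]
  rcases hH ⟨h, hh⟩ ⟨h', hh'⟩ with H1 | H1 | H1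
  · left
    have hhh : h * h = 1 := by rw [sq] at H1; exact congrArg Subtype.val H1
    calc (e * h) ^ 2 = e * (h * e) * h := by rw [sq]; group
      _ = (e * e) * (h * h) := by rw [← hcomm e h he hh]; group
      _ = 1 := by rw [hee, hhh, one_mul]
  · right; left
    exact congrArg (e * ·) (congrArg Subtype.val H1)
  · right; right
    have : h' * h * h'⁻¹ = h⁻¹ := congrArg Subtype.val H1
    rw [this, mul_inv_rev, ← hcomm e⁻¹ h⁻¹ (inv_mem he) (inv_mem hh), inv_eq_of_mul_eq_one_left hee]

end DirectProduct

/-! ### Groups inverted by an involution -/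

/-- `G` is generated by an abelian subgroup `A` and an element `x` outside `A`, of order `2`, which
inverts every element of `A`; the coset `A x` is the complement of `A`. -/
structure IsInvertedBy {G : Type*} [Group G] (A : Subgroup G) (x : G) : Prop where
  comm : ∀ a ∈ A, ∀ b ∈ A, a * b = b * a
  mul_self : x * x = 1
  notMem : x ∉ A
  inv : ∀ a ∈ A, x * a = a⁻¹ * x
  cover : ∀ g, g ∈ A ∨ g * x ∈ A

namespace IsInvertedBy

variable {G : Type*} [Group G] {A : Subgroup G} {x : G}

theorem inv_eq (h : IsInvertedBy A x) : x⁻¹ = x := inv_eq_of_mul_eq_one_left h.mul_self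

theorem exists_eq_mul (h : IsInvertedBy A x) {g : G} (hg : g ∉ A) : ∃ a ∈ A, g = a * x :=
  ⟨g * x, (h.cover g).resolve_left hg, by rw [mul_assoc, h.mul_self, mul_one]⟩

theorem conjEqSelfOrInv (h : IsInvertedBy A x) : ConjEqSelfOrInv G := by
  intro g y
  by_cases hg : g ∈ A
  · right
    by_cases hy : y ∈ A
    · left
      rw [h.comm y hy g hg, mul_inv_cancel_right]
    · right
      obtain ⟨b, hb, rfl⟩ := h.exists_eq_mul hy
      rw [mul_assoc b, h.inv g hg, ← mul_assoc, h.comm b hb _ (inv_mem hg)]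
      group
  · left
    obtain ⟨a, ha, rfl⟩ := h.exists_eq_mul hg
    calc (a * x) ^ 2 = a * (x * a) * x := by rw [sq]; group
      _ = x * x := by rw [h.inv a ha]; group
      _ = 1 := h.mul_self

theorem isInvertingSemidirectProduct (h : IsInvertedBy A x) (hp : IsPGroup 2 G) :
    IsInvertingSemidirectProduct G := by
  have hord : orderOf x = 2 :=
    orderOf_eq_prime (by rw [sq, h.mul_self]) fun e => h.notMem (e ▸ one_mem A)
  refine ⟨x, A, hord, ⟨fun a ha g => ?_⟩, ?_, hp.to_subgroup A, h.comm, fun a ha => ?_⟩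
  · by_cases hg : g ∈ A
    · exact mul_mem (mul_mem hg ha) (inv_mem hg)
    · obtain ⟨b, hb, rfl⟩ := h.exists_eq_mul hg
      have : b * x * a * (b * x)⁻¹ = b * a⁻¹ * b⁻¹ := by
        rw [mul_assoc b, h.inv a ha]; group
      rw [this]
      exact mul_mem (mul_mem hb (inv_mem ha)) (inv_mem hb)
  · refine Subgroup.isComplement'_of_disjoint_and_mul_eq_univ ?_ ?_
    · rw [Subgroup.disjoint_def]
      intro y hy hyx
      obtain ⟨k, rfl⟩ := Subgroup.mem_zpowers_iff.1 hyx
      rcases Int.even_or_odd' k with ⟨m, rfl | rfl⟩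
      · rw [zpow_mul, zpow_two, h.mul_self, one_zpow]
      · rw [zpow_add, zpow_mul, zpow_two, h.mul_self, one_zpow, one_mul, zpow_one] at hy
        exact absurd hy h.notMem
    · rw [Set.eq_univ_iff_forall]
      intro g
      by_cases hg : g ∈ A
      · exact ⟨g, hg, 1, one_mem _, mul_one g⟩
      · obtain ⟨b, hb, rfl⟩ := h.exists_eq_mul hg
        exact ⟨b, hb, x, Subgroup.mem_zpowers x, rfl⟩
  · rw [h.inv_eq, h.inv a ha, mul_assoc, h.mul_self, mul_one]

/-- A direct factor of order `2` is generated by a central involution `c`. In a nonabelian `G`, such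
a `c` lies in `A`, hence is a square by assumption; but squares lie in the complementary factor. -/
theorem not_hasDirectFactorOfOrderTwo (h : IsInvertedBy A x)
    (hna : ¬ ∀ g k : G, g * k = k * g) (hsq : ∀ a ∈ A, a * a = 1 → ∃ b ∈ A, b * b = a) :
    ¬ HasDirectFactorOfOrderTwo G := by
  rintro ⟨C, D, ⟨hC, hD, hCD⟩, hcard⟩
  obtain ⟨c, hc1, hc⟩ := (Nat.card_eq_two_iff' (1 : C)).1 hcard
  have hcc : ∀ d : C, d * d = 1 := fun d => by
    have := pow_card_eq_one' (x := d)
    rwa [hcard, sq] at this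
  have hcentral : ∀ g : G, (c : G) * g = g * c := fun g => by
    have := hc ⟨g * c * g⁻¹, hC.conj_mem c c.2 g⟩ (fun e => hc1 (by
      have e' : g * c * g⁻¹ = 1 := congrArg Subtype.val e
      exact Subtype.ext (conj_eq_one_iff.1 e')))
    have this' : g * c * g⁻¹ = c := congrArg Subtype.val this
    nth_rw 1 [← this']
    group
  have hcA : (c : G) ∈ A := by
    by_contra hcA
    obtain ⟨b, hb, hbc⟩ := h.exists_eq_mul hcA
    have hA : ∀ a ∈ A, a⁻¹ = a := fun a ha => by
      have h1 := hcentral a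
      rw [hbc, mul_assoc, h.inv a ha, ← mul_assoc, ← mul_assoc, h.comm b hb _ (inv_mem ha)] at h1
      exact mul_right_cancel (mul_right_cancel h1)
    have hxA : ∀ a ∈ A, x * a = a * x := fun a ha => by rw [h.inv a ha, hA a ha]
    have hAc : ∀ a ∈ A, ∀ g, a * g = g * a := fun a ha g => by
      by_cases hg : g ∈ A
      · exact h.comm a ha g hg
      · obtain ⟨d, hd, rfl⟩ := h.exists_eq_mul hg
        rw [← mul_assoc, h.comm a ha d hd, mul_assoc, ← hxA a ha, mul_assoc]
    refine hna fun g k => ?_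
    by_cases hg : g ∈ A
    · exact hAc g hg k
    · obtain ⟨d, hd, rfl⟩ := h.exists_eq_mul hg
      by_cases hk : k ∈ A
      · exact (hAc k hk _).symm
      · obtain ⟨d', hd', rfl⟩ := h.exists_eq_mul hk
        calc d * x * (d' * x) = d * (x * d') * x := by group
          _ = d * d' * (x * x) := by rw [hxA d' hd']; group
          _ = d' * (d * x) * x := by rw [h.comm d hd d' hd']; group
          _ = d' * (x * d) * x := by rw [hxA d hd]
          _ = d' * x * (d * x) := by group
  obtain ⟨b, hb, hbc⟩ := hsq c hcA (congrArg Subtype.val (hcc c))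
  obtain ⟨⟨d, k⟩, hdk⟩ := hCD.2 b
  have hdk' : (d : G) * k = b := hdk
  have hcomm : (k : G) * d = d * k :=
    (Subgroup.commute_of_normal_of_disjoint C D hC hD hCD.disjoint d k d.2 k.2).eq.symm
  have hcD : (c : G) ∈ D := by
    have hdd : (d : G) * d = 1 := congrArg Subtype.val (hcc d)
    have : (c : G) = k * k := by
      calc (c : G) = d * k * (d * k) := by rw [hdk', hbc]
        _ = d * (k * d) * k := by group
        _ = d * d * k * k := by rw [hcomm]; group
        _ = k * k := by rw [hdd, one_mul]
    rw [this]
    exact mul_mem k.2 k.2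
  exact hc1 (Subtype.ext (Subgroup.disjoint_def.1 hCD.disjoint c.2 hcD))

end IsInvertedBy

theorem IsInvertingSemidirectProduct.conjEqSelfOrInv {H : Type*} [Group H]
    (h : IsInvertingSemidirectProduct H) : ConjEqSelfOrInv H := by
  obtain ⟨x, A, hx, -, hc, -, hcomm, hinv⟩ := h
  have hxx : x * x = 1 := by rw [← sq, ← hx, pow_orderOf_eq_one]
  have hxi : x⁻¹ = x := inv_eq_of_mul_eq_one_left hxx
  refine IsInvertedBy.conjEqSelfOrInv (A := A) (x := x) ⟨hcomm, hxx, fun hxA => ?_, fun a ha => ?_,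
    fun g => ?_⟩
  · have := Subgroup.disjoint_def.1 hc.disjoint hxA (Subgroup.mem_zpowers x)
    rw [this, orderOf_one] at hx
    omega
  · rw [← hinv a ha, hxi, mul_assoc, hxx, mul_one]
  · obtain ⟨⟨⟨a, ha⟩, ⟨y, hy⟩⟩, hg⟩ := hc.2 g
    have hg' : a * y = g := hg
    obtain ⟨k, rfl⟩ := Subgroup.mem_zpowers_iff.1 hy
    rcases Int.even_or_odd' k with ⟨m, rfl | rfl⟩
    · rw [zpow_mul, zpow_two, hxx, one_zpow, mul_one] at hg'
      exact Or.inl (hg' ▸ ha)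
    · rw [zpow_add, zpow_mul, zpow_two, hxx, one_zpow, one_mul, zpow_one] at hg'
      right
      rw [← hg', mul_assoc, hxx, mul_one]
      exact ha

/-! ### Groups with squares and commutators in a central subgroup of order two -/

open scoped commutatorElement

/-- `z` is a central element of order `2`, and `{1, z}` contains the square of every element and
(the second alternative of `mul_eq`) every commutator. -/
structure SquaresCommutatorsIn {G : Type*} [Group G] (z : G) : Prop where
  ne_one : z ≠ 1
  mul_self : z * z = 1
  comm : ∀ g, z * g = g * z
  sq_eq : ∀ g : G, g * g = 1 ∨ g * g = z
  mul_eq : ∀ x g : G, x * g = g * x ∨ x * g = g * x * z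

theorem mem_zpowers_iff_of_mul_self {G : Type*} [Group G] {z : G} (hz : z * z = 1) {y : G} :
    y ∈ Subgroup.zpowers z ↔ y = 1 ∨ y = z := by
  constructor
  · intro hy
    obtain ⟨k, rfl⟩ := Subgroup.mem_zpowers_iff.1 hy
    rcases Int.even_or_odd' k with ⟨m, rfl | rfl⟩
    · left
      rw [zpow_mul, zpow_two, hz, one_zpow]
    · right
      rw [zpow_add, zpow_mul, zpow_two, hz, one_zpow, one_mul, zpow_one]
  · rintro (rfl | rfl)
    · exact one_mem _
    · exact Subgroup.mem_zpowers _

namespace SquaresCommutatorsIn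

variable {G : Type*} [Group G] {z : G}

theorem conjEqSelfOrInv (h : SquaresCommutatorsIn z) : ConjEqSelfOrInv G := by
  intro g x
  rcases h.sq_eq g with hg | hg
  · left
    rw [sq, hg]
  · right
    rcases h.mul_eq x g with hx | hx
    · left
      rw [hx, mul_inv_cancel_right]
    · right
      rw [hx, mul_assoc g, ← h.comm, mul_assoc, mul_assoc, mul_inv_cancel, mul_one, ← hg,
        eq_inv_iff_mul_eq_one, mul_assoc, mul_assoc, hg, ← mul_assoc, hg, h.mul_self]

theorem mul_self_mem (h : SquaresCommutatorsIn z) (g : G) : g * g ∈ Subgroup.zpowers z :=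
  (mem_zpowers_iff_of_mul_self h.mul_self).2 (h.sq_eq g)

theorem subgroup (h : SquaresCommutatorsIn z) {S : Subgroup G} (hz : z ∈ S) :
    SquaresCommutatorsIn (⟨z, hz⟩ : S) where
  ne_one e := h.ne_one (congrArg Subtype.val e)
  mul_self := Subtype.ext h.mul_self
  comm g := Subtype.ext (h.comm g)
  sq_eq g := (h.sq_eq g).imp Subtype.ext Subtype.ext
  mul_eq x g := (h.mul_eq x g).imp Subtype.ext Subtype.ext

/-- An element `g` outside `{1, z}` is avoided by a complement `M` of `⟨g⟩` modulo `⟨z⟩`, which has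
index `2` and so is a maximal subgroup. -/
theorem frattini_le (h : SquaresCommutatorsIn z) : frattini G ≤ Subgroup.zpowers z := by
  intro g hg
  by_contra hgz
  obtain ⟨M, hzM, hdec, hinf⟩ :=
    exists_complement_modulo_of_forall h.mul_self_mem (Subgroup.zpowers g)
  have hgM : g ∉ M := fun hgM => hgz (hinf g (Subgroup.mem_zpowers g) hgM)
  have hggM : g * g ∈ M := hzM (h.mul_self_mem g)
  refine hgM (frattini_le_coatom ⟨fun e => hgM (by rw [e]; trivial), fun L hML => ?_⟩ hg)
  obtain ⟨hle, l, hl, hlM⟩ := SetLike.lt_iff_le_and_exists.1 hML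
  have key : ∀ e ∈ Subgroup.zpowers g, e ∈ M ∨ e * g⁻¹ ∈ M := by
    intro e he
    obtain ⟨k, rfl⟩ := Subgroup.mem_zpowers_iff.1 he
    rcases Int.even_or_odd' k with ⟨m, rfl | rfl⟩
    · left
      rw [zpow_mul, zpow_two]
      exact zpow_mem hggM m
    · right
      rw [zpow_add, zpow_one, mul_inv_cancel_right, zpow_mul, zpow_two]
      exact zpow_mem hggM m
  have hgL : g ∈ L := by
    obtain ⟨e, he, m, hm, rfl⟩ := hdec l
    have heL : e ∈ L := (Subgroup.mul_mem_cancel_right L (hle hm)).1 hl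
    have heM : e ∉ M := fun heM => hlM (mul_mem heM hm)
    have := hle ((key e he).resolve_left heM)
    rwa [Subgroup.mul_mem_cancel_left L heL, inv_mem_iff] at this
  rw [eq_top_iff]
  intro y _
  obtain ⟨e, he, m, hm, rfl⟩ := hdec y
  exact mul_mem (Subgroup.zpowers_le.2 hgL he) (hle hm)

/-- A maximal subgroup `M` not containing the central element `z` satisfies `G = M⟨z⟩`, so that
the commutator subgroup of `G` is that of `M` and does not contain `z`. -/
theorem le_frattini_of_mem_commutator (h : SquaresCommutatorsIn z) (hz : z ∈ commutator G) :
    Subgroup.zpowers z ≤ frattini G := by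
  rw [Subgroup.zpowers_le, frattini, Order.radical, Subgroup.mem_iInf]
  intro M
  rw [Subgroup.mem_iInf]
  intro hM
  by_contra hzM
  have htop : M ⊔ Subgroup.zpowers z = ⊤ :=
    hM.2 _ (lt_of_le_of_ne le_sup_left fun e => hzM (by
      rw [e]
      exact Subgroup.mem_sup_right (Subgroup.mem_zpowers z)))
  have hcen : ∀ c ∈ Subgroup.zpowers z, ∀ g, c * g = g * c := by
    intro c hc g
    rcases (mem_zpowers_iff_of_mul_self h.mul_self).1 hc with rfl | rfl
    · rw [one_mul, mul_one]
    · exact h.comm g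
  have hN : (Subgroup.zpowers z).Normal := ⟨fun c hc g => by
    rw [← hcen c hc g, mul_inv_cancel_right]
    exact hc⟩
  have hdec : ∀ g : G, ∃ m ∈ M, ∃ c ∈ Subgroup.zpowers z, m * c = g := fun g =>
    Subgroup.mem_sup_of_normal_right.1 (htop ▸ Subgroup.mem_top g)
  refine hzM ((Subgroup.commutator_le.2 fun g _ k _ => ?_ : commutator G ≤ M) hz)
  obtain ⟨m, hm, c, hc, rfl⟩ := hdec g
  obtain ⟨n, hn, d, hd, rfl⟩ := hdec k
  have : ⁅m * c, n * d⁆ = ⁅m, n⁆ := by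
    rw [commutatorElement_def, commutatorElement_def]
    calc m * c * (n * d) * (m * c)⁻¹ * (n * d)⁻¹
        = m * (c * (n * d)) * c⁻¹ * m⁻¹ * (n * d)⁻¹ := by group
      _ = m * n * (d * m⁻¹) * (n * d)⁻¹ := by rw [hcen c hc]; group
      _ = _ := by rw [hcen d hd]; group
  rw [this]
  exact mul_mem (mul_mem (mul_mem hm hn) (inv_mem hm)) (inv_mem hn)

theorem isExtraspecial (h : SquaresCommutatorsIn z)
    (hcen : ∀ c : G, (∀ g, c * g = g * c) → c = 1 ∨ c = z)
    (hna : ¬ ∀ g k : G, g * k = k * g) : IsExtraspecial 2 G := by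
  have hc : Subgroup.center G = Subgroup.zpowers z := by
    ext c
    rw [mem_zpowers_iff_of_mul_self h.mul_self, Subgroup.mem_center_iff]
    refine ⟨fun hc => hcen c fun g => (hc g).symm, ?_⟩
    rintro (rfl | rfl) g
    · rw [one_mul, mul_one]
    · exact (h.comm g).symm
  have hcomm : ∀ x g : G, ⁅x, g⁆ = 1 ∨ ⁅x, g⁆ = z := fun x g => by
    rw [commutatorElement_def]
    rcases h.mul_eq x g with hx | hx
    · left
      rw [hx]; group
    · right
      rw [hx, ← h.comm]; group
  have hmem : z ∈ commutator G := by
    push Not at hna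
    obtain ⟨x, g, hxg⟩ := hna
    rw [← (hcomm x g).resolve_left fun e => hxg (commutatorElement_eq_one_iff_mul_comm.1 e)]
    exact Subgroup.commutator_mem_commutator (Subgroup.mem_top x) (Subgroup.mem_top g)
  refine ⟨fun g => ⟨2, ?_⟩, ?_, ?_, ?_⟩
  · rw [show 2 ^ 2 = 2 * 2 from rfl, pow_mul, sq, sq]
    rcases h.sq_eq g with e | e
    · rw [e, one_mul]
    · rw [e, h.mul_self]
  · rw [hc]
    refine le_antisymm (Subgroup.zpowers_le.2 hmem) (Subgroup.commutator_le.2 fun x _ g _ => ?_)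
    exact (mem_zpowers_iff_of_mul_self h.mul_self).2 (hcomm x g)
  · rw [hc]
    exact le_antisymm (h.le_frattini_of_mem_commutator hmem) h.frattini_le
  · rw [hc, Nat.card_zpowers]
    exact orderOf_eq_prime (by rw [sq, h.mul_self]) h.ne_one

theorem isExtraspecial_subgroup (h : SquaresCommutatorsIn z) {S : Subgroup G} (hz : z ∈ S)
    (hcen : ∀ c ∈ S, (∀ g ∈ S, c * g = g * c) → c = 1 ∨ c = z)
    (hna : ¬ ∀ g ∈ S, ∀ k ∈ S, g * k = k * g) : IsExtraspecial 2 S := by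
  refine (h.subgroup hz).isExtraspecial (fun c hc => ?_) fun hcomm => hna fun g hg k hk =>
    congrArg Subtype.val (hcomm ⟨g, hg⟩ ⟨k, hk⟩)
  exact (hcen c c.2 fun g hg => congrArg Subtype.val (hc ⟨g, hg⟩)).imp Subtype.ext Subtype.ext

/-- The subgroup `S ∪ S c⁻¹` generated by a subgroup `S` and a central element `c` with `c² ∈ S`. -/
def adjoinCentral (S : Subgroup G) (c : G) (hc : ∀ g, c * g = g * c) (hcc : c * c ∈ S) :
    Subgroup G where
  carrier := {g | g ∈ S ∨ g * c ∈ S}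
  one_mem' := Or.inl (one_mem S)
  mul_mem' := by
    rintro a b (ha | ha) (hb | hb)
    · exact Or.inl (mul_mem ha hb)
    · right
      rw [mul_assoc]
      exact mul_mem ha hb
    · right
      rw [mul_assoc, ← hc, ← mul_assoc]
      exact mul_mem ha hb
    · left
      have : a * c * (b * c) = a * b * (c * c) := by
        rw [mul_assoc a c, hc (b * c)]; group
      rw [← Subgroup.mul_mem_cancel_right S hcc, ← this]
      exact mul_mem ha hb
  inv_mem' := by
    rintro a (ha | ha)
    · exact Or.inl (inv_mem ha)
    · right
      have : a⁻¹ * c = (a * c)⁻¹ * (c * c) := by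
        rw [← hc a]; group
      rw [this]
      exact mul_mem (inv_mem ha) hcc

theorem isCentralProductExtraspecialC4 (h : SquaresCommutatorsIn z) {S : Subgroup G} (hz : z ∈ S)
    (hcen : ∀ c ∈ S, (∀ g ∈ S, c * g = g * c) → c = 1 ∨ c = z)
    (hna : ¬ ∀ g ∈ S, ∀ k ∈ S, g * k = k * g) {c : G} (hc : ∀ g, c * g = g * c) (hcz : c * c = z)
    (hcover : ∀ g, g ∈ S ∨ g * c ∈ S) : IsCentralProductExtraspecialC4 G := by
  have hc4 : orderOf c = 4 :=
    orderOf_eq_prime_pow (p := 2) (n := 1) (by rw [pow_one, sq, hcz]; exact h.ne_one)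
      (by rw [show 2 ^ (1 + 1) = 2 * 2 from rfl, pow_mul, sq, sq, hcz, h.mul_self])
  have hCc : ∀ d ∈ Subgroup.zpowers c, ∀ g, d * g = g * d := by
    intro d hd g
    obtain ⟨k, rfl⟩ := Subgroup.mem_zpowers_iff.1 hd
    exact ((show Commute c g from hc g).zpow_left k).eq
  refine ⟨S, Subgroup.zpowers c, h.isExtraspecial_subgroup hz hcen hna, inferInstance,
    by rw [Nat.card_zpowers, hc4], fun s _ d hd => (hCc d hd s).symm, ?_, ?_⟩
  · rw [eq_top_iff]
    intro g _
    rcases hcover g with hg | hg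
    · exact Subgroup.mem_sup_left hg
    · rw [← mul_inv_cancel_right g c]
      exact mul_mem (Subgroup.mem_sup_left hg)
        (inv_mem (Subgroup.mem_sup_right (Subgroup.mem_zpowers c)))
  · ext y
    constructor
    · rintro ⟨hyS, hyc⟩
      exact ⟨⟨y, hyS⟩, Subgroup.mem_center_iff.2 fun g => Subtype.ext (hCc y hyc g).symm, rfl⟩
    · rintro ⟨y, hy, rfl⟩
      refine ⟨y.2, ?_⟩
      rcases hcen y y.2 fun g hg =>
        (congrArg Subtype.val (Subgroup.mem_center_iff.1 hy ⟨g, hg⟩)).symm with e | e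
      · simp [e]
      · rw [Subgroup.subtype_apply, e, ← hcz]
        exact mul_mem (Subgroup.mem_zpowers c) (Subgroup.mem_zpowers c)

/-- Here `S` is a complement of the centre of `G` modulo `⟨z⟩`, which makes it extraspecial, and `E`
is a complement of `⟨z⟩` in the group `Ω` of central elements of order at most `2`. If the centre is
larger than `Ω`, it contains an element `c` with `c² = z`, and the centre is `E × ⟨c⟩`. -/
theorem exists_isDirectProductOf (h : SquaresCommutatorsIn z) (hna : ¬ ∀ g k : G, g * k = k * g) :
    ∃ E H : Subgroup G, IsDirectProductOf E H ∧ IsElementaryAbelian 2 E ∧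
      (IsExtraspecial 2 H ∨ IsCentralProductExtraspecialC4 H) := by
  have hmz : ∀ {y : G}, y ∈ Subgroup.zpowers z ↔ y = 1 ∨ y = z :=
    mem_zpowers_iff_of_mul_self h.mul_self
  have hcen : ∀ {c : G}, c ∈ Subgroup.center G ↔ ∀ g, c * g = g * c := by
    intro c
    rw [Subgroup.mem_center_iff]
    exact forall_congr' fun g => eq_comm
  let Ω : Subgroup G :=
    { carrier := {c | c ∈ Subgroup.center G ∧ c * c = 1}
      one_mem' := ⟨one_mem _, one_mul 1⟩
      mul_mem' := fun {a b} ha hb => ⟨mul_mem ha.1 hb.1, by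
        have := hcen.1 hb.1 a
        calc a * b * (a * b) = a * (b * a) * b := by group
          _ = (a * a) * (b * b) := by rw [this]; group
          _ = 1 := by rw [ha.2, hb.2, one_mul]⟩
      inv_mem' := fun {a} ha => ⟨inv_mem ha.1, by rw [← mul_inv_rev, ha.2, inv_one]⟩ }
  have hΩ : ∀ {c}, c ∈ Ω ↔ c ∈ Subgroup.center G ∧ c * c = 1 := Iff.rfl
  obtain ⟨E, -, hEΩ, hEdec, hEinf⟩ := exists_complement_modulo (D := ⊥) (P := Ω) bot_le
    (fun c hc => Subgroup.mem_bot.2 hc.2) (Subgroup.zpowers z)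
  obtain ⟨S, hzS, hSdec, hSinf⟩ :=
    exists_complement_modulo_of_forall h.mul_self_mem (Subgroup.center G)
  have hzS' : z ∈ S := hzS (Subgroup.mem_zpowers z)
  have hEc : ∀ e ∈ E, ∀ g, e * g = g * e := fun e he => hcen.1 (hEΩ he).1
  have hEz : ∀ e ∈ E, e ∈ Subgroup.zpowers z → e = 1 := fun e he hez =>
    Subgroup.mem_bot.1 (hEinf e hez he)
  have hEel : IsElementaryAbelian 2 E := isElementaryAbelian_two_of_forall fun e he => (hEΩ he).2
  have hScen : ∀ c ∈ S, (∀ g ∈ S, c * g = g * c) → c = 1 ∨ c = z := by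
    intro c hc hcS
    refine hmz.1 (hSinf c (hcen.2 fun g => ?_) hc)
    obtain ⟨d, hd, s, hs, rfl⟩ := hSdec g
    rw [← mul_assoc, ← hcen.1 hd c, mul_assoc, hcS s hs, mul_assoc]
  have hSna : ¬ ∀ g ∈ S, ∀ k ∈ S, g * k = k * g := by
    intro hS
    refine hna fun g k => ?_
    obtain ⟨c, hc, s, hs, rfl⟩ := hSdec g
    obtain ⟨d, hd, t, ht, rfl⟩ := hSdec k
    have hc := hcen.1 hc
    have hd := hcen.1 hd
    calc c * s * (d * t) = c * (s * d) * t := by group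
      _ = c * d * (s * t) := by rw [← hd]; group
      _ = d * c * (t * s) := by rw [hc, hS s hs t ht]
      _ = d * (c * t) * s := by group
      _ = d * t * (c * s) := by rw [hc t]; group
  have hΩdec : ∀ c ∈ Ω, ∀ s ∈ S, ∃ e ∈ E, ∃ t ∈ S, e * t = c * s := by
    intro c hc s hs
    obtain ⟨y, hy, e, he, rfl⟩ := hEdec c hc
    exact ⟨e, he, y * s, mul_mem (hzS hy) hs, by rw [hEc e he, mul_assoc, mul_assoc, hEc e he]⟩
  by_cases hΩc : Subgroup.center G ≤ Ω
  · refine ⟨E, S, isDirectProductOf_of_central hEc (fun g => ?_) (fun e he heS => ?_), hEel,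
      Or.inl (h.isExtraspecial_subgroup hzS' hScen hSna)⟩
    · obtain ⟨c, hc, s, hs, rfl⟩ := hSdec g
      exact hΩdec c (hΩc hc) s hs
    · exact hEz e he (hSinf e (hEΩ he).1 heS)
  · obtain ⟨c, hc, hcΩ⟩ := SetLike.not_le_iff_exists.1 hΩc
    have hcz : c * c = z := (h.sq_eq c).resolve_left fun e => hcΩ ⟨hc, e⟩
    have hc' := hcen.1 hc
    let H := adjoinCentral S c hc' (hcz ▸ hzS')
    have hcH : c ∈ H := Or.inr (hcz ▸ hzS')
    have hSH : S ≤ H := fun s hs => Or.inl hs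
    refine ⟨E, H, isDirectProductOf_of_central hEc (fun g => ?_) (fun e he heH => ?_), hEel,
      Or.inr ?_⟩
    · obtain ⟨d, hd, s, hs, rfl⟩ := hSdec g
      rcases h.sq_eq d with hdd | hdd
      · obtain ⟨e, he, t, ht, het⟩ := hΩdec d ⟨hd, hdd⟩ s hs
        exact ⟨e, he, t, hSH ht, het⟩
      · have hdc : d * c ∈ Ω := ⟨mul_mem hd hc, by
          calc d * c * (d * c) = d * (c * d) * c := by group
            _ = (d * d) * (c * c) := by rw [hc' d]; group
            _ = 1 := by rw [hdd, hcz, h.mul_self]⟩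
        obtain ⟨e, he, t, ht, het⟩ := hΩdec _ hdc s hs
        refine ⟨e, he, t * c⁻¹, mul_mem (hSH ht) (inv_mem hcH), ?_⟩
        rw [← mul_assoc, het, mul_assoc d, hc' s]
        group
    · rcases heH with heS | heS
      · exact hEz e he (hSinf e (hEΩ he).1 heS)
      · exfalso
        have hec := hmz.1 (hSinf _ (mul_mem (hEΩ he).1 hc) heS)
        have hsq : e * c * (e * c) = z := by
          calc e * c * (e * c) = e * (c * e) * c := by group
            _ = (e * e) * (c * c) := by rw [hc' e]; group
            _ = z := by rw [(hEΩ he).2, hcz, one_mul]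
        rcases hec with e1 | e1
        · rw [e1, one_mul] at hsq
          exact h.ne_one hsq.symm
        · rw [e1, h.mul_self] at hsq
          exact h.ne_one hsq.symm
    · refine (h.subgroup (S := H) (hSH hzS')).isCentralProductExtraspecialC4
        (S := S.subgroupOf H) (Subgroup.mem_subgroupOf.2 hzS') (fun d hd hdS => ?_) (fun hS => ?_)
        (c := ⟨c, hcH⟩) (fun g => Subtype.ext (hc' g)) (Subtype.ext hcz) (fun g => g.2)
      · exact (hScen d hd fun g hg =>
          congrArg Subtype.val (hdS ⟨g, hSH hg⟩ hg)).imp Subtype.ext Subtype.ext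
      · exact hSna fun g hg k hk => congrArg Subtype.val (hS ⟨g, hSH hg⟩ hg ⟨k, hSH hk⟩ hk)

end SquaresCommutatorsIn

theorem IsExtraspecial.exists_squaresCommutatorsIn {S : Type*} [Group S] (h : IsExtraspecial 2 S) :
    ∃ z : S, SquaresCommutatorsIn z ∧ ∀ c, c ∈ Subgroup.center S ↔ c = 1 ∨ c = z := by
  obtain ⟨-, hcomm, -, hcard⟩ := h
  obtain ⟨z, hz1, hz⟩ := (Nat.card_eq_two_iff' (1 : Subgroup.center S)).1 hcard
  have hcen : ∀ c, c ∈ Subgroup.center S ↔ c = 1 ∨ c = z := by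
    intro c
    constructor
    · intro hc
      by_cases h1 : c = 1
      · exact Or.inl h1
      · exact Or.inr (congrArg Subtype.val
          (hz ⟨c, hc⟩ fun e => h1 (congrArg Subtype.val e)))
    · rintro (rfl | rfl)
      · exact one_mem _
      · exact z.2
  have hzc : ∀ g, (z : S) * g = g * z := fun g => (Subgroup.mem_center_iff.1 z.2 g).symm
  have hz1' : (z : S) ≠ 1 := fun e => hz1 (Subtype.ext e)
  have hzz : (z : S) * z = 1 :=
    ((hcen _).1 (mul_mem z.2 z.2)).resolve_right fun e => hz1' (mul_eq_left.1 e)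
  have hmul : ∀ x g : S, x * g = g * x ∨ x * g = g * x * z := by
    intro x g
    have hmem : ⁅x, g⁆ ∈ Subgroup.center S := by
      rw [hcomm]
      exact Subgroup.commutator_mem_commutator (Subgroup.mem_top x) (Subgroup.mem_top g)
    have hxg : x * g = ⁅x, g⁆ * (g * x) := by rw [commutatorElement_def]; group
    rcases (hcen _).1 hmem with e | e
    · left
      rw [hxg, e, one_mul]
    · right
      rw [hxg, e, hzc]
  refine ⟨z, ⟨hz1', hzz, hzc, fun g => ?_, hmul⟩, hcen⟩
  refine (hcen _).1 (Subgroup.mem_center_iff.2 fun x => ?_)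
  rcases hmul x g with e | e
  · rw [← mul_assoc, e, mul_assoc, e, mul_assoc]
  · calc x * (g * g) = x * g * g := by group
      _ = g * x * (z * g) := by rw [e]; group
      _ = g * (x * g) * z := by rw [hzc]; group
      _ = g * g * x * (z * z) := by rw [e]; group
      _ = g * g * x := by rw [hzz, mul_one]

theorem IsCentralProductExtraspecialC4.exists_squaresCommutatorsIn {H : Type*} [Group H]
    (h : IsCentralProductExtraspecialC4 H) : ∃ z : H, SquaresCommutatorsIn z := by
  obtain ⟨S, C, hS, hC, hcard, hcomm, htop, hinf⟩ := h
  obtain ⟨z, hz, hcen⟩ := hS.exists_squaresCommutatorsIn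
  have hCc : ∀ c ∈ C, ∀ g : H, c * g = g * c := by
    have hle : S ⊔ C ≤ Subgroup.centralizer (C : Set H) := sup_le
      (fun s hs => Subgroup.mem_centralizer_iff.2 fun c hc => (hcomm s hs c hc).symm)
      (fun d hd => Subgroup.mem_centralizer_iff.2 fun c hc => by
        obtain ⟨k, hk⟩ := hC
        obtain ⟨i, hi⟩ := hk ⟨c, hc⟩
        obtain ⟨j, hj⟩ := hk ⟨d, hd⟩
        have := zpow_mul_comm k i j
        simp only at hi hj
        rw [hi, hj] at this
        exact congrArg Subtype.val this)
    intro c hc g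
    exact Subgroup.mem_centralizer_iff.1 (hle (htop ▸ Subgroup.mem_top g)) c hc
  have hCn : C.Normal := ⟨fun c hc g => by rwa [← hCc c hc g, mul_inv_cancel_right]⟩
  have hdec : ∀ g : H, ∃ s ∈ S, ∃ c ∈ C, s * c = g := fun g =>
    Subgroup.mem_sup_of_normal_right.1 (htop ▸ Subgroup.mem_top g)
  have hzz : (z : H) * z = 1 := congrArg Subtype.val hz.mul_self
  have hz1 : (z : H) ≠ 1 := fun e => hz.ne_one (Subtype.ext e)
  have hzC : (z : H) ∈ C := by
    have : (z : H) ∈ S ⊓ C := by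
      rw [hinf]
      exact ⟨z, (hcen z).2 (Or.inr rfl), rfl⟩
    exact this.2
  have hCsq : ∀ c ∈ C, c * c = 1 ∨ c * c = z := by
    intro c hc
    obtain ⟨k, hk⟩ := hC.exists_generator
    have hk4 : orderOf k = 4 := hcard ▸ orderOf_eq_card_of_forall_mem_zpowers hk
    have hkk1 : k * k ≠ 1 := fun e => by
      have := orderOf_dvd_of_pow_eq_one (x := k) (n := 2) (by rw [sq, e])
      rw [hk4] at this
      omega
    have hkk : (k * k) * (k * k) = 1 := by
      rw [← sq, ← sq, ← pow_mul, show 2 * 2 = orderOf k from hk4.symm, pow_orderOf_eq_one]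
    have hzk : (⟨z, hzC⟩ : C) = k * k := by
      obtain ⟨i, hi⟩ := Subgroup.mem_zpowers_iff.1 (hk ⟨z, hzC⟩)
      rcases Int.even_or_odd' i with ⟨m, rfl | rfl⟩
      · have : (⟨z, hzC⟩ : C) ∈ Subgroup.zpowers (k * k) := ⟨m, by
          rw [← hi, zpow_mul, zpow_two]⟩
        exact ((mem_zpowers_iff_of_mul_self hkk).1 this).resolve_left
          fun e => hz1 (congrArg Subtype.val e)
      · exfalso
        have h1 : (k ^ (2 * m + 1)) * k ^ (2 * m + 1) = 1 := by
          rw [hi]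
          exact Subtype.ext hzz
        rw [← zpow_add, show 2 * m + 1 + (2 * m + 1) = 2 * (2 * m) + 2 by ring, zpow_add, zpow_mul,
          zpow_two, zpow_mul, zpow_two, hkk, one_zpow, one_mul] at h1
        exact hkk1 h1
    obtain ⟨j, hj⟩ := Subgroup.mem_zpowers_iff.1 (hk ⟨c, hc⟩)
    have hcc : (⟨c, hc⟩ * ⟨c, hc⟩ : C) ∈ Subgroup.zpowers (k * k) := ⟨j, by
      change (k * k) ^ j = _
      rw [← hj, ← zpow_two, ← zpow_two, ← zpow_mul, ← zpow_mul, mul_comm]⟩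
    rw [mem_zpowers_iff_of_mul_self hkk, ← hzk] at hcc
    exact hcc.imp (congrArg Subtype.val) (congrArg Subtype.val)
  refine ⟨z, hz1, hzz, hCc z hzC, fun g => ?_, fun x g => ?_⟩
  · obtain ⟨s, hs, c, hc, rfl⟩ := hdec g
    have : s * c * (s * c) = (s * s) * (c * c) := by
      rw [mul_assoc s c, hCc c hc]; group
    rw [this]
    rcases hz.sq_eq ⟨s, hs⟩ with e1 | e1 <;> rcases hCsq c hc with e2 | e2 <;>
      replace e1 := congrArg Subtype.val e1 <;> simp only [Subgroup.coe_mul, Subgroup.coe_one] at e1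
    · left; rw [e1, e2, one_mul]
    · right; rw [e1, e2, one_mul]
    · right; rw [e1, e2, mul_one]
    · left; rw [e1, e2, hzz]
  · obtain ⟨s, hs, c, hc, rfl⟩ := hdec x
    obtain ⟨t, ht, d, hd, rfl⟩ := hdec g
    have e0 : s * c * (t * d) = s * t * (c * d) := by
      rw [mul_assoc s c, hCc c hc, mul_assoc t, ← hCc c hc d]; group
    have e0' : t * d * (s * c) = t * s * (c * d) := by
      rw [mul_assoc t d, hCc d hd, mul_assoc s]; group
    rw [e0, e0']
    rcases hz.mul_eq ⟨s, hs⟩ ⟨t, ht⟩ with e | e <;> replace e : _ = _ := congrArg Subtype.val e <;>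
      simp only [Subgroup.coe_mul] at e
    · left; rw [e]
    · right; rw [e, mul_assoc _ (z : H), hCc z hzC, mul_assoc (t * s)]

/-! ### The groups in which elements are conjugate at most to themselves and their inverses -/

section Classification

variable {G : Type*} [Group G]

/-- Let `Sq` be the group of squares of `A`, and `Ω` that of its elements of order at most `2`.
Then `E` is a complement of `Sq ⊓ Ω` in `Ω`, and `B` is a complement of `E` in `A` which contains
`Sq`. All involutions of `B` are squares in `B`, and `G = E × H` with `H = B ∪ B x`. -/
theorem IsInvertedBy.exists_isDirectProductOf {A : Subgroup G} {x : G} (h : IsInvertedBy A x)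
    (hp : IsPGroup 2 G) (hna : ¬ ∀ g k : G, g * k = k * g) :
    ∃ E H : Subgroup G, IsDirectProductOf E H ∧ IsElementaryAbelian 2 E ∧
      ¬ HasDirectFactorOfOrderTwo H ∧ IsInvertingSemidirectProduct H := by
  have hcomm4 : ∀ a ∈ A, ∀ b ∈ A, a * b * (a * b) = a * a * (b * b) := fun a ha b hb => by
    calc a * b * (a * b) = a * (b * a) * b := by group
      _ = a * a * (b * b) := by rw [h.comm b hb a ha]; group
  let Sq : Subgroup G :=
    { carrier := {y | ∃ a ∈ A, a * a = y}
      one_mem' := ⟨1, one_mem A, one_mul 1⟩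
      mul_mem' := by
        rintro _ _ ⟨a, ha, rfl⟩ ⟨b, hb, rfl⟩
        exact ⟨a * b, mul_mem ha hb, hcomm4 a ha b hb⟩
      inv_mem' := by
        rintro _ ⟨a, ha, rfl⟩
        exact ⟨a⁻¹, inv_mem ha, (mul_inv_rev a a).symm⟩ }
  let Ω : Subgroup G :=
    { carrier := {a | a ∈ A ∧ a * a = 1}
      one_mem' := ⟨one_mem A, one_mul 1⟩
      mul_mem' := by
        rintro a b ⟨ha, haa⟩ ⟨hb, hbb⟩
        exact ⟨mul_mem ha hb, by rw [hcomm4 a ha b hb, haa, hbb, one_mul]⟩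
      inv_mem' := by
        rintro a ⟨ha, haa⟩
        exact ⟨inv_mem ha, by rw [← mul_inv_rev, haa, inv_one]⟩ }
  have hSqA : Sq ≤ A := by
    rintro _ ⟨a, ha, rfl⟩
    exact mul_mem ha ha
  obtain ⟨E, -, hEΩ, hEdec, hEinf⟩ := exists_complement_modulo (D := ⊥) (P := Ω) bot_le
    (fun c hc => Subgroup.mem_bot.2 hc.2) Sq
  obtain ⟨B, hSqB, hBA, hBdec, hBinf⟩ := exists_complement_modulo (D := Sq) (P := A) hSqA
    (fun c hc => ⟨c, hc, rfl⟩) E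
  have hEc : ∀ e ∈ E, ∀ g, e * g = g * e := by
    intro e he g
    obtain ⟨heA, hee⟩ := hEΩ he
    by_cases hg : g ∈ A
    · exact h.comm e heA g hg
    · obtain ⟨a, ha, rfl⟩ := h.exists_eq_mul hg
      rw [mul_assoc a, h.inv e heA, inv_eq_of_mul_eq_one_left hee, ← mul_assoc, ← mul_assoc,
        h.comm e heA a ha]
  have hEB : ∀ e ∈ E, e ∈ B → e = 1 := fun e he heB =>
    Subgroup.mem_bot.1 (hEinf e (hBinf e he heB) he)
  have hxB : ∀ b, b * x ∈ B → x * b = (b * x)⁻¹ := fun b hb => by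
    have := h.inv (b * x) (hBA hb)
    rw [← mul_assoc] at this
    exact mul_right_cancel this
  let H : Subgroup G :=
    { carrier := {g | g ∈ B ∨ g * x ∈ B}
      one_mem' := Or.inl (one_mem B)
      mul_mem' := by
        rintro a b (ha | ha) (hb | hb)
        · exact Or.inl (mul_mem ha hb)
        · right
          rw [mul_assoc]
          exact mul_mem ha hb
        · right
          have : a * b * x = a * x * b⁻¹ := by
            have := h.inv b⁻¹ (inv_mem (hBA hb))
            rw [inv_inv] at this
            rw [mul_assoc, ← this, mul_assoc]
          rw [this]
          exact mul_mem ha (inv_mem hb)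
        · left
          have : a * b = a * x * (b * x)⁻¹ := by
            rw [← hxB b hb, mul_assoc a, ← mul_assoc x, h.mul_self, one_mul]
          rw [this]
          exact mul_mem ha (inv_mem hb)
      inv_mem' := by
        rintro a (ha | ha)
        · exact Or.inl (inv_mem ha)
        · right
          have : a⁻¹ * x = a * x := by
            rw [← inv_inj, ← hxB a ha, mul_inv_rev, h.inv_eq, inv_inv]
          rw [this]
          exact ha }
  have hxH : x ∈ H := Or.inr (by rw [h.mul_self]; exact one_mem B)
  have hBH : B ≤ H := fun b hb => Or.inl hb
  have hinv : IsInvertedBy (B.subgroupOf H) (⟨x, hxH⟩ : H) :=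
    { comm := fun a ha b hb => Subtype.ext (h.comm a (hBA ha) b (hBA hb))
      mul_self := Subtype.ext h.mul_self
      notMem := fun hx => h.notMem (hBA hx)
      inv := fun a ha => Subtype.ext (h.inv a (hBA ha))
      cover := fun g => g.2 }
  have hdec : ∀ g, ∃ e ∈ E, ∃ k ∈ H, e * k = g := by
    intro g
    by_cases hg : g ∈ A
    · obtain ⟨e, he, b, hb, rfl⟩ := hBdec g hg
      exact ⟨e, he, b, hBH hb, rfl⟩
    · obtain ⟨a, ha, rfl⟩ := h.exists_eq_mul hg
      obtain ⟨e, he, b, hb, rfl⟩ := hBdec a ha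
      exact ⟨e, he, b * x, mul_mem (hBH hb) hxH, (mul_assoc _ _ _).symm⟩
  have hHna : ¬ ∀ g k : H, g * k = k * g := by
    intro hH
    refine hna fun g k => ?_
    obtain ⟨e, he, s, hs, rfl⟩ := hdec g
    obtain ⟨f, hf, t, ht, rfl⟩ := hdec k
    have hst : s * t = t * s := congrArg Subtype.val (hH ⟨s, hs⟩ ⟨t, ht⟩)
    calc e * s * (f * t) = e * (s * f) * t := by group
      _ = e * f * (s * t) := by rw [← hEc f hf]; group
      _ = f * e * (t * s) := by rw [hEc e he f, hst]
      _ = f * (e * t) * s := by group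
      _ = f * t * (e * s) := by rw [hEc e he t]; group
  refine ⟨E, H, isDirectProductOf_of_central hEc hdec (fun e he heH => ?_),
    isElementaryAbelian_two_of_forall fun e he => (hEΩ he).2,
    hinv.not_hasDirectFactorOfOrderTwo hHna fun b hb hbb => ?_,
    hinv.isInvertingSemidirectProduct (hp.to_subgroup H)⟩
  · rcases heH with heB | heB
    · exact hEB e he heB
    · exact absurd ((Subgroup.mul_mem_cancel_left A (hEΩ he).1).1 (hBA heB)) h.notMem
  · have hbB : (b : G) ∈ B := hb
    obtain ⟨s, hs, e, he, hse⟩ := hEdec b ⟨hBA hbB, congrArg Subtype.val hbb⟩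
    have heB : e ∈ B := (Subgroup.mul_mem_cancel_left B (hSqB hs)).1 (hse ▸ hbB)
    rw [hEB e he heB, mul_one] at hse
    obtain ⟨a, ha, rfl⟩ := hs
    obtain ⟨f, hf, d, hd, rfl⟩ := hBdec a ha
    refine ⟨⟨d, hBH hd⟩, hd, Subtype.ext ?_⟩
    rw [← hse, hcomm4 f (hEΩ hf).1 d (hBA hd), (hEΩ hf).2, one_mul]
    rfl

/-- If every `y` outside the centralizer of `g` is an involution, then so is every `x c` with `c` in
the centralizer; this says that `x` inverts `c`, and forces the centralizer to be abelian. -/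
theorem ConjEqSelfOrInv.isInvertedBy_centralizer (hG : ConjEqSelfOrInv G) {g x : G}
    (hg : g * g ≠ 1) (hxg : x * g ≠ g * x) (hinv : ∀ y, y * g ≠ g * y → y * y = 1) :
    IsInvertedBy (Subgroup.centralizer {g}) x := by
  have hmem : ∀ {y}, y ∈ Subgroup.centralizer {g} ↔ y * g = g * y := fun {y} => by
    rw [Subgroup.mem_centralizer_singleton_iff]
  have hxi : x⁻¹ = x := inv_eq_of_mul_eq_one_left (hinv x hxg)
  have hconj : ∀ c ∈ Subgroup.centralizer {g}, x * c = c⁻¹ * x := by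
    intro c hc
    have hxc : x * c ∉ Subgroup.centralizer {g} := fun hm =>
      hxg (hmem.1 ((Subgroup.mul_mem_cancel_right _ hc).1 hm))
    have := eq_inv_of_mul_eq_one_left (hinv _ (fun e => hxc (hmem.2 e)))
    rwa [mul_inv_rev, hxi] at this
  have hflip : ∀ y, y * g ≠ g * y → y * g = g⁻¹ * y := by
    intro y hy
    rcases hG g y with e | e | e
    · exact absurd (sq g ▸ e) hg
    · exact absurd (mul_inv_eq_iff_eq_mul.1 e) hy
    · exact mul_inv_eq_iff_eq_mul.1 e
  refine ⟨fun a ha b hb => ?_, hinv x hxg, fun hx => hxg (hmem.1 hx), hconj, fun y => ?_⟩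
  · have h1 := hconj _ (mul_mem ha hb)
    rw [← mul_assoc, hconj a ha, mul_assoc, hconj b hb, ← mul_assoc] at h1
    have h2 := mul_right_cancel h1
    rw [← mul_inv_rev, inv_inj] at h2
    exact h2.symm
  · by_cases hy : y * g = g * y
    · exact Or.inl (hmem.2 hy)
    · right
      rw [hmem, mul_assoc, hflip x hxg, ← mul_assoc]
      have := hflip y hy
      have h3 : y * g⁻¹ = g * y := by
        rw [mul_inv_eq_iff_eq_mul, mul_assoc, this, mul_inv_cancel_left]
      rw [h3, mul_assoc]

/-- The elements `g` and `x` invert each other and hence generate a quaternion group `Q`, with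
`g² = x²` central of order `2`. Conjugation by any `y` agrees on `Q` with conjugation by `1`, `g`,
`x` or `g x`, so `G` is generated by `Q` and its centralizer, whose elements are controlled by
applying the hypothesis to `c` and to `g c`. -/
theorem ConjEqSelfOrInv.squaresCommutatorsIn (hG : ConjEqSelfOrInv G) {g x : G}
    (hg : g * g ≠ 1) (hx : x * x ≠ 1) (hxg : x * g ≠ g * x) :
    SquaresCommutatorsIn (g * g) := by
  have hcase : ∀ {c : G}, c * c ≠ 1 → ∀ w, w * c = c * w ∨ w * c = c⁻¹ * w := by
    intro c hc w
    rcases hG c w with e | e | e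
    · exact absurd (sq c ▸ e) hc
    · exact Or.inl (mul_inv_eq_iff_eq_mul.1 e)
    · exact Or.inr (mul_inv_eq_iff_eq_mul.1 e)
  have h1 : x * g = g⁻¹ * x := (hcase hg x).resolve_left hxg
  have h2 : g * x = x⁻¹ * g := (hcase hx g).resolve_left fun e => hxg e.symm
  have h1' : x * g⁻¹ = g * x := by rw [mul_inv_eq_iff_eq_mul, mul_assoc, h1, mul_inv_cancel_left]
  have hxx : x * x = g * g := by
    have : x * g⁻¹ = x⁻¹ * g := by rw [h1', h2]
    rwa [eq_inv_mul_iff_mul_eq, ← mul_assoc, mul_inv_eq_iff_eq_mul] at this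
  have hzz : g * g * (g * g) = 1 := by
    have h3 : x * (g * g) = (g * g)⁻¹ * x := by
      rw [← mul_assoc, h1, mul_assoc, h1, mul_inv_rev, mul_assoc]
    rw [← inv_eq_iff_mul_eq_one]
    refine (mul_right_cancel (b := x) ?_)
    rw [← h3, ← hxx, mul_assoc]
  have hgi : g⁻¹ = g * (g * g) := by
    rw [inv_eq_iff_mul_eq_one, ← mul_assoc]
    exact hzz
  obtain ⟨z, hz⟩ : ∃ z, g * g = z := ⟨_, rfl⟩
  rw [hz] at hzz hxx hgi hg ⊢
  have hzc : ∀ w, z * w = w * z := by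
    intro w
    rw [← hz]
    rcases hcase (hz ▸ hg) w with e | e
    · rw [← mul_assoc w, e, mul_assoc g w, e, mul_assoc]
    · have : w * (g * g) = (g * g)⁻¹ * w := by
        rw [← mul_assoc, e, mul_assoc, e, mul_inv_rev, mul_assoc]
      rw [this, hz, inv_eq_of_mul_eq_one_left hzz]
  have hxg' : x * g = g * x * z := by rw [h1, hgi, mul_assoc, hzc, mul_assoc]
  have hgx' : g * x = x * g * z := by rw [hxg', mul_assoc _ z, hzz, mul_one]
  -- `T` is the set of elements all of whose commutators lie in `{1, z}`.
  let T : Submonoid G :=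
    { carrier := {y | ∀ w, w * y = y * w ∨ w * y = y * w * z}
      one_mem' := fun w => Or.inl (by rw [mul_one, one_mul])
      mul_mem' := by
        intro a b ha hb w
        rcases ha w with e1 | e1 <;> rcases hb w with e2 | e2
        · left; rw [← mul_assoc, e1, mul_assoc, e2, mul_assoc]
        · right; rw [← mul_assoc, e1, mul_assoc, e2]; group
        · right; rw [← mul_assoc, e1, mul_assoc _ z, hzc, ← mul_assoc, mul_assoc a, e2]; group
        · left
          rw [← mul_assoc, e1, mul_assoc _ z, hzc, ← mul_assoc, mul_assoc a, e2, ← mul_assoc,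
            mul_assoc _ z z, hzz, mul_one, mul_assoc] }
  have hTsq : ∀ {y}, y * y = z → y ∈ T := by
    intro y hy w
    refine (hcase (hy ▸ hg) w).imp_right fun e => ?_
    have hyi : y⁻¹ = y * z := by
      rw [inv_eq_iff_mul_eq_one, ← mul_assoc, hy, hzz]
    rw [e, hyi, mul_assoc, hzc, mul_assoc]
  -- Given the condition on commutators, squaring is multiplicative modulo `z`.
  let U : Submonoid G :=
    { carrier := {y | y ∈ T ∧ (y * y = 1 ∨ y * y = z)}
      one_mem' := ⟨one_mem T, Or.inl (one_mul 1)⟩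
      mul_mem' := by
        rintro a b ⟨ha, haa⟩ ⟨hb, hbb⟩
        refine ⟨mul_mem ha hb, ?_⟩
        have : a * b * (a * b) = a * a * (b * b) ∨ a * b * (a * b) = a * a * (b * b) * z := by
          have h0 : a * b * (a * b) = a * (b * a) * b := by group
          rw [h0]
          rcases ha b with e | e
          · left; rw [e]; group
          · right; rw [e, ← mul_assoc, mul_assoc _ z, hzc]; group
        rcases this with e | e <;> rcases haa with e1 | e1 <;> rcases hbb with e2 | e2 <;>
          simp [e, e1, e2, hzz] }
  have hgU : g ∈ U := ⟨hTsq hz, Or.inr hz⟩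
  have hxU : x ∈ U := ⟨hTsq hxx, Or.inr hxx⟩
  have hUC : ∀ {c}, c * g = g * c → c * x = x * c → c ∈ U := by
    intro c hcg hcx
    have hgc2 : g * c * (g * c) = z * (c * c) := by
      calc g * c * (g * c) = g * (c * g) * c := by group
        _ = g * g * (c * c) := by rw [hcg]; group
        _ = _ := by rw [hz]
    have hcc : c * c = 1 ∨ c * c = z := by
      by_contra! hcon
      have hne : g * c * (g * c) ≠ 1 := by
        rw [hgc2]
        intro e
        exact hcon.2 (mul_left_cancel (e.trans hzz.symm))
      have hxgc : x * (g * c) = g⁻¹ * c * x := by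
        rw [← mul_assoc, h1, mul_assoc, ← hcx, mul_assoc]
      rcases hcase hne x with e | e <;> rw [hxgc] at e <;> have e' := mul_right_cancel e
      · have := mul_right_cancel e'
        exact hg (by rw [← hz, ← inv_eq_iff_mul_eq_one, this])
      · rw [← hcg, mul_inv_rev] at e'
        exact hcon.1 (mul_eq_one_iff_eq_inv.2 (mul_left_cancel e'))
    refine ⟨?_, hcc⟩
    rcases hcc with e | e
    · have hgc : g * c ∈ T := hTsq (by rw [hgc2, e, mul_one])
      have : c = g * g * g * (g * c) := by
        rw [← mul_assoc, mul_assoc _ g g, hz, hzz, one_mul]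
      rw [this]
      exact mul_mem (mul_mem (mul_mem hgU.1 hgU.1) hgU.1) hgc
    · exact hTsq e
  have hU : ∀ y, y ∈ U := by
    intro y
    have hyg := hgU.1 y
    have hyx := hxU.1 y
    -- It suffices to correct `y` by some `q` in `Q` so that `y q` centralizes `Q`.
    have key : ∀ q ∈ U, q * q = z → y * q * g = g * (y * q) → y * q * x = x * (y * q) → y ∈ U := by
      intro q hq hqq e1 e2
      have : y = y * q * (q * q * q) := by
        calc y = y * (z * z) := by rw [hzz, mul_one]
          _ = y * q * (q * q * q) := by rw [← hqq]; group
      rw [this]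
      exact mul_mem (hUC e1 e2) (mul_mem (mul_mem hq hq) hq)
    have hff : ∀ {a b w : G}, a * w = w * a * z → b * w = w * b * z →
        a * b * w = w * (a * b) := by
      intro a b w ha hb
      calc a * b * w = a * w * (b * z) := by rw [mul_assoc, hb]; group
        _ = w * a * (z * b) * z := by rw [ha]; group
        _ = w * a * b * (z * z) := by rw [hzc]; group
        _ = w * (a * b) := by rw [hzz]; group
    have hcc : ∀ {a b w : G}, a * w = w * a → b * w = w * b → a * b * w = w * (a * b) := by
      intro a b w ha hb
      rw [mul_assoc, hb, ← mul_assoc, ha, mul_assoc]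
    rcases hyg with e1 | e1 <;> rcases hyx with e2 | e2
    · exact hUC e1 e2
    · exact key g hgU hz (hcc e1 rfl) (hff e2 hgx')
    · exact key x hxU hxx (hff e1 hxg') (hcc e2 rfl)
    · refine key (g * x) (mul_mem hgU hxU) ?_ (hff e1 ?_) (hff e2 ?_)
      · rw [mul_assoc, ← mul_assoc x, h1, ← mul_assoc, ← mul_assoc, mul_inv_cancel, one_mul, hxx]
      · rw [mul_assoc, hxg', ← mul_assoc, ← mul_assoc]
      · calc g * x * x = x * g * (z * x) := by rw [hgx', mul_assoc]
          _ = x * (g * x) * z := by rw [hzc]; group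
  exact ⟨hg, hzz, hzc, fun y => (hU y).2, fun w y => (hU y).1 w⟩

/-- Some `g` with `g² ≠ 1` is not central: if `a`, `b` are involutions that do not commute, then
`a b` is such an element. -/
theorem ConjEqSelfOrInv.exists_isInvertedBy_or (hG : ConjEqSelfOrInv G)
    (hna : ¬ ∀ g k : G, g * k = k * g) :
    (∃ (A : Subgroup G) (x : G), IsInvertedBy A x) ∨ ∃ z : G, SquaresCommutatorsIn z := by
  obtain ⟨g, hg, x, hxg⟩ : ∃ g : G, g * g ≠ 1 ∧ ∃ x, x * g ≠ g * x := by
    by_contra! hcon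
    refine hna fun a b => ?_
    by_contra hab
    have haa : a * a = 1 := by
      by_contra haa
      exact hab (hcon a haa b).symm
    have hbb : b * b = 1 := by
      by_contra hbb
      exact hab (hcon b hbb a)
    have hne : a * b * (a * b) ≠ 1 := fun e => hab (by
      rw [eq_inv_of_mul_eq_one_left e, mul_inv_rev, inv_eq_of_mul_eq_one_left haa,
        inv_eq_of_mul_eq_one_left hbb])
    have := hcon _ hne a
    rw [mul_assoc a b a] at this
    exact hab (mul_left_cancel this)
  by_cases hinv : ∀ y, y * g ≠ g * y → y * y = 1
  · exact Or.inl ⟨_, x, hG.isInvertedBy_centralizer hg hxg hinv⟩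
  · push Not at hinv
    obtain ⟨y, hyg, hyy⟩ := hinv
    exact Or.inr ⟨_, hG.squaresCommutatorsIn hg hyy hyg⟩

end Classification

theorem theorem1p1 (p : ℕ) [Fact p.Prime] (K : Type*) [Field K] [CharP K p]
    (G : Type*) [Group G] (hp : IsPGroup p G) (hlf : IsLocallyFiniteGroup G)
    (hna : ¬ ∀ x y : G, x * y = y * x) :
    (unitaryNormalizedUnits K G).Normal ↔
      p = 2 ∧ ∃ E H : Subgroup G,
        IsDirectProductOf E H ∧ IsElementaryAbelian 2 E ∧
        ((¬ HasDirectFactorOfOrderTwo H ∧ IsInvertingSemidirectProduct H) ∨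
          (IsExtraspecial 2 H ∨ IsCentralProductExtraspecialC4 H)) := by
  constructor
  · intro hN
    have hp2 : p = 2 := by
      by_contra hp2
      exact hna (mul_comm_of_normal hp2 hp hlf hN)
    subst hp2
    refine ⟨rfl, ?_⟩
    rcases (conjEqSelfOrInv_of_normal hp hlf hN).exists_isInvertedBy_or hna with
      ⟨A, x, h⟩ | ⟨z, h⟩
    · obtain ⟨E, H, hEH, hE, hH⟩ := h.exists_isDirectProductOf hp hna
      exact ⟨E, H, hEH, hE, Or.inl hH⟩
    · obtain ⟨E, H, hEH, hE, hH⟩ := h.exists_isDirectProductOf hna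
      exact ⟨E, H, hEH, hE, Or.inr hH⟩
  · rintro ⟨rfl, E, H, hEH, hE, hH⟩
    refine unitaryNormalizedUnits_normal_of_conjEqSelfOrInv
      (ConjEqSelfOrInv.of_isDirectProductOf hEH hE ?_)
    rcases hH with ⟨-, hH⟩ | hH | hH
    · exact hH.conjEqSelfOrInv
    · obtain ⟨z, hz, -⟩ := hH.exists_squaresCommutatorsIn
      exact hz.conjEqSelfOrInv
    · obtain ⟨z, hz⟩ := hH.exists_squaresCommutatorsIn
      exact hz.conjEqSelfOrInv
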